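/- All graphs are finite, simple and undirected. For $k\ge 1$, a $k$-strong forest of a graph $G$ is an induced subgraph of $G$ that is acyclic and each of whose connected components has at least $k$ edges. An edge of $G$ is $k$-valid if some $k$-strong forest of $G$ contains it, and $f_k(G)$ is the smallest number of $k$-strong forests of $G$ that together cover all $k$-valid edges of $G$ (so $f_k(G)=0$ if there are none). Let $\chi_{\rm acyc}(G)$ be the smallest number of colors in a proper vertex coloring of $G$ in which any two color classes induce a forest; let $a'(G)$ be the smallest number of (not necessarily induced) forests in $G$ that cover all edges of $G$; let $\operatorname{tw}(G)$ be the tree-width of $G$; and let $\operatorname{td}(G)$ be the tree-depth of $G$, that is, the smallest $d$ such that each connected component of $G$ is a subgraph of the transitive closure of a rooted tree in which every path ending at the root has at most $d$ vertices. For an integer $d\ge 0$, a graph $G$ is a $d$-shallow minor of a graph $H$ if there are pairwise disjoint vertex sets $B_v\subseteq V(H)$, $v\in V(G)$, each inducing a connected subgraph of $H$ of radius at most $d$, such that for each edge $uv$ of $G$ some edge of $H$ joins $B_u$ and $B_v$. A class $\mathcal{C}$ of graphs is nowhere dense if for each integer $d\ge 0$ some graph is not a $d$-shallow minor of any graph in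 $\mathcal{C}$; and $\mathcal{C}$ is $f_k$-bounded if there is a constant $c$ with $f_k(G)\le c$ for all $G\in\mathcal{C}$. **Theorem 2.** (i) For each graph $G$ we have $\log_3(\chi_{\rm acyc}(G)) \le f_1(G) \le \binom{\chi_{\rm acyc}(G)}{2}$. (For the graph without vertices the first inequality is void.) (ii) For any integers $k,n\ge 1$, and for each item below, there is a graph $G$ satisfying the listed conditions: (a) $a'(G)=2$ and $f_k(G)\ge n$; (b) $f_k(G)\le 3$ and $f_{k+1}(G)\ge n$; (c) $f_k(G)\ge n$ and $f_{k+1}(G)=0$; (d) $f_k(G)=3$ and $G$ has an induced subgraph $H$ with $f_k(H)\ge k$; (e) $\operatorname{tw}(G)=2$ and $f_k(G)\ge k$; (f) $\operatorname{td}(G)=3$ and $f_k(G)\ge k-1$. (iii) There is a class $\mathcal{C}$ of graphs that is nowhere dense, but not $f_k$-bounded for any $k\ge 1$. (iv) There is a class $\mathcal{C}$ of graphs that is $f_k$-bounded for every $k\ge 1$, but not nowhere dense. -/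

import Mathlib

namespace StrongArboricity

open SimpleGraph

/-- A finite simple graph, bundled with its vertex set. -/
structure FinGraph where
  /-- The vertex set. -/
  V : Type
  /-- The vertex set is finite. -/
  [finite : Finite V]
  /-- The adjacency structure. -/
  graph : SimpleGraph V

attribute [instance] FinGraph.finite

/-- A class of (finite) graphs. -/
abbrev GraphClass := Set FinGraph

section Parameters

variable {V : Type*} (G : SimpleGraph V)

/-- The subgraph of `G` induced by `S` is a `k`-strong forest: it is acyclic and each of its
connected components has at least `k` edges. Induced subgraphs are identified with their
vertex sets. -/
def IsStrongForest (k : ℕ) (S : Set V) : Prop :=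
  (G.induce S).IsAcyclic ∧
    ∀ c : (G.induce S).ConnectedComponent, (k : ℕ∞) ≤ c.toSimpleGraph.edgeSet.encard

/-- The edges of `G` that belong to the subgraph of `G` induced by `S`. -/
def inducedEdges (S : Set V) : Set (Sym2 V) :=
  {e | e ∈ G.edgeSet ∧ ∀ v ∈ e, v ∈ S}

/-- The edge `e` of `G` is `k`-valid: some `k`-strong forest of `G` contains it. -/
def IsValidEdge (k : ℕ) (e : Sym2 V) : Prop :=
  ∃ S : Set V, IsStrongForest G k S ∧ e ∈ inducedEdges G S

/-- The `k`-strong induced arboricity `f_k(G)`: the smallest number of `k`-strong forests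
that together cover all `k`-valid edges of `G`. -/
noncomputable def strongArboricity (k : ℕ) : ℕ :=
  sInf {t | ∃ F : Fin t → Set V, (∀ i, IsStrongForest G k (F i)) ∧
    ∀ e, IsValidEdge G k e → ∃ i, e ∈ inducedEdges G (F i)}

/-- The acyclic chromatic number: the smallest number of colors in a proper coloring in which
any two color classes induce a forest. -/
noncomputable def acyclicChromaticNumber : ℕ :=
  sInf {m | ∃ c : G.Coloring (Fin m),
    ∀ a b : Fin m, (G.induce {v | c v = a ∨ c v = b}).IsAcyclic}

/-- The edge arboricity `a'(G)`: the smallest number of forests in `G`, not necessarily induced,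
that together cover all edges of `G`. (Adding isolated vertices to a forest changes nothing, so
the forests are taken on the whole vertex set.) -/
noncomputable def edgeArboricity : ℕ :=
  sInf {t | ∃ F : Fin t → SimpleGraph V, (∀ i, F i ≤ G ∧ (F i).IsAcyclic) ∧
    ∀ e ∈ G.edgeSet, ∃ i, e ∈ (F i).edgeSet}

/-- `(T, B)` is a tree decomposition of `G`: `T` is a tree, each vertex `v` of `G` has a non-empty
set `B v` of vertices of `T` inducing a connected subgraph of `T`, and adjacent vertices
have intersecting sets. -/
def IsTreeDecomposition {ι : Type*} (T : SimpleGraph ι) (B : V → Set ι) : Prop :=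
  T.IsTree ∧ (∀ v, (B v).Nonempty ∧ (T.induce (B v)).Connected) ∧
    ∀ u v, G.Adj u v → (B u ∩ B v).Nonempty

/-- The tree-width of `G`: the smallest `w` such that `G` has a tree decomposition `(T, B)`
with finite `T` in which every vertex of `T` belongs to at most `w + 1` of the sets `B v`. -/
noncomputable def treeWidth : ℕ :=
  sInf {w | ∃ (ι : Type) (_ : Finite ι) (T : SimpleGraph ι) (B : V → Set ι),
    IsTreeDecomposition G T B ∧ ∀ x : ι, {v | x ∈ B v}.encard ≤ (w : ℕ∞) + 1}

end Parameters

/-- The transitive closure of the tree `T` rooted at `r`: two distinct vertices are adjacent if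
and only if one of them lies on the path of `T` from the other one to `r`. (For adjacent vertices
of `T` this always holds, so the edges of `T` are included.) -/
def rootedClosure {ι : Type*} (T : SimpleGraph ι) (r : ι) : SimpleGraph ι :=
  SimpleGraph.fromRel fun u v => ∃ p : T.Walk u r, p.IsPath ∧ v ∈ p.support

/-- `T` is a tree and every path of `T` that ends in `r` has at most `d` vertices. -/
def IsRootedTreeOfDepthLE {ι : Type*} (T : SimpleGraph ι) (r : ι) (d : ℕ) : Prop :=
  T.IsTree ∧ ∀ (u : ι) (p : T.Walk u r), p.IsPath → p.support.length ≤ d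

/-- The tree-depth of `G`: the smallest `d` such that each connected component of `G` is (up to
isomorphism) a subgraph of the transitive closure of a finite rooted tree of depth at most `d`. -/
noncomputable def treeDepth {V : Type*} (G : SimpleGraph V) : ℕ :=
  sInf {d | ∀ c : G.ConnectedComponent,
    ∃ (ι : Type) (_ : Finite ι) (T : SimpleGraph ι) (r : ι),
      IsRootedTreeOfDepthLE T r d ∧ c.toSimpleGraph.IsContained (rootedClosure T r)}

/-- `G` is a `d`-shallow minor of `H`: there are pairwise disjoint sets `B v` of vertices of `H`,
one for each vertex `v` of `G`, each inducing a connected subgraph of radius at most `d`, such that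
for each edge `uv` of `G` there is an edge of `H` between `B u` and `B v`. -/
def IsShallowMinor {V W : Type*} (d : ℕ) (G : SimpleGraph V) (H : SimpleGraph W) : Prop :=
  ∃ B : V → Set W,
    (∀ u v, u ≠ v → Disjoint (B u) (B v)) ∧
    (∀ v, (H.induce (B v)).Connected ∧
      ∃ c : B v, ∀ x : B v, (H.induce (B v)).dist c x ≤ d) ∧
    ∀ u v, G.Adj u v → ∃ x ∈ B u, ∃ y ∈ B v, H.Adj x y

/-- A class of graphs is nowhere dense if for each `d` some graph is not a `d`-shallow minor of
any graph in the class. -/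
def IsNowhereDenseClass (C : GraphClass) : Prop :=
  ∀ d : ℕ, ∃ G : FinGraph, ∀ H ∈ C, ¬ IsShallowMinor d G.graph H.graph

/-- A class of graphs is `f_k`-bounded if `f_k` is bounded by a constant on it. -/
def IsStrongArboricityBounded (k : ℕ) (C : GraphClass) : Prop :=
  ∃ c : ℕ, ∀ G ∈ C, strongArboricity G.graph k ≤ c

end StrongArboricity

/-! ### Strong forests: certificates, size bounds and counting covers -/

namespace StrongArboricity

open SimpleGraph

/-! For (i), every edge is 1-valid. Two-colourings of the forests in a cover, with a third colour
outside each forest, combine into an acyclic colouring; conversely, the non-isolated vertices of two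
colour classes induce a 1-strong forest.

The lower bounds in (ii) use that the forests are induced and their components large. A component
that would be too small without a certain vertex must contain it (`IsStrongForest.card_le`), and the
forced vertices close a triangle, a square or a hexagon. Either this makes a family of valid edges
pairwise incompatible (`card_le_strongArboricity`), or it is applied after two pigeonholes: among
more than `2 ^ t` branch vertices two lie in the same ones of `t` forests, and among more than `t`
parallel paths between them two are covered by the same forest. Upper bounds come from explicit
covers, certified by a rank function (`IsStrongForest.of_rank`).

For (iii), take graphs whose girth and minimum degree both grow. A forest has fewer edges than
vertices, so `f_k` is at least half the minimum degree, while a shallow triangle minor forces a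
short cycle. For (iv), complete multigraphs with twice subdivided edges contain all graphs as
1-shallow minors; leaves on the subdivided edges let three `k`-strong forests cover everything. -/

theorem isAcyclic_of_rank {V : Type*} {G : SimpleGraph V} (h : V → ℕ) (par : V → V)
    (H : ∀ v u, G.Adj v u → h u ≤ h v → u = par v) : G.IsAcyclic := by
  classical
  intro v p hp
  -- At a vertex of maximal rank on the cycle, both cycle neighbours would have to be its parent.
  obtain ⟨x, hx, hmax⟩ := p.support.toFinset.exists_max_image h ⟨v, by simp⟩
  have hx' : x ∈ p.support := by simpa using hx
  have hq := hp.rotate hx'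
  set q := p.rotate x hx' with hqdef
  have hsup : ∀ z ∈ q.support, h z ≤ h x := by
    intro z hz
    apply hmax
    rw [List.mem_toFinset]
    exact (Walk.mem_support_rotate_iff p x hx').1 hz
  have h1 := H x q.snd (q.adj_snd hq.not_nil) (hsup _ (q.getVert_mem_support _))
  have h2 := H x q.penultimate (q.adj_penultimate hq.not_nil).symm
    (hsup _ (q.getVert_mem_support _))
  exact hq.snd_ne_penultimate (h1.trans h2.symm)

theorem not_isAcyclic_of_triangle {V : Type*} {G : SimpleGraph V} {a b c : V}
    (hab : G.Adj a b) (hbc : G.Adj b c) (hac : G.Adj a c) : ¬ G.IsAcyclic := by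
  intro h
  have := (h.subsingleton_path _ _).elim ⟨.cons hac .nil, by simp [hac.ne]⟩
    ⟨.cons hab (.cons hbc .nil), by simp [hac.ne, hab.ne, hbc.ne]⟩
  simp [hbc.ne'] at this

theorem not_isAcyclic_of_square {V : Type*} {G : SimpleGraph V} {a b c d : V}
    (hab : G.Adj a b) (hbc : G.Adj b c) (had : G.Adj a d) (hdc : G.Adj d c)
    (hac : a ≠ c) (hbd : b ≠ d) : ¬ G.IsAcyclic := by
  intro h
  have := (h.subsingleton_path _ _).elim ⟨.cons hab (.cons hbc .nil), by simp [hac, hab.ne, hbc.ne]⟩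
    ⟨.cons had (.cons hdc .nil), by simp [hac, had.ne, hdc.ne]⟩
  simp [hbd] at this

theorem not_isAcyclic_of_hexagon {V : Type*} {G : SimpleGraph V} {u s s' v t t' : V}
    (h1 : G.Adj u s) (h2 : G.Adj s s') (h3 : G.Adj s' v)
    (h4 : G.Adj u t) (h5 : G.Adj t t') (h6 : G.Adj t' v)
    (huv : u ≠ v) (hus : u ≠ s') (hsv : s ≠ v) (hut : u ≠ t') (htv : t ≠ v) (hst : s ≠ t) :
    ¬ G.IsAcyclic := by
  intro h
  have := (h.subsingleton_path _ _).elim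
    ⟨.cons h1 (.cons h2 (.cons h3 .nil)), by simp [h1.ne, h2.ne, h3.ne, huv, hus, hsv]⟩
    ⟨.cons h4 (.cons h5 (.cons h6 .nil)), by simp [h4.ne, h5.ne, h6.ne, huv, hut, htv]⟩
  simp [hst] at this

theorem le_encard_of_injective {V ι : Type*} [Finite ι] {k : ℕ} {A : Set V} (hk : k ≤ Nat.card ι)
    (f : ι → V) (hf : Function.Injective f) (hA : ∀ i, f i ∈ A) : (k : ℕ∞) ≤ A.encard := by
  have h1 : Set.range f ⊆ A := by rintro _ ⟨i, rfl⟩; exact hA i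
  have h2 := Set.encard_le_encard h1
  rw [← Set.image_univ, hf.encard_image, Set.encard_univ, ENat.card_eq_coe_natCard] at h2
  exact (Nat.cast_le.2 hk).trans h2

section

variable {V : Type*} {G : SimpleGraph V} {k : ℕ} {S : Set V}

theorem mem_inducedEdges_iff {u v : V} :
    s(u, v) ∈ inducedEdges G S ↔ G.Adj u v ∧ u ∈ S ∧ v ∈ S := by
  simp [inducedEdges]

/-- Descending along `h` inside a component ends at a vertex with `k` neighbours in `S`, whose star
supplies the `k` edges. -/
theorem IsStrongForest.of_isAcyclic (hS : (G.induce S).IsAcyclic) (h : V → ℕ)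
    (hc : ∀ v ∈ S, (k : ℕ∞) ≤ (G.neighborSet v ∩ S).encard ∨ ∃ u ∈ S, G.Adj v u ∧ h u < h v) :
    IsStrongForest G k S := by
  classical
  refine ⟨hS, ?_⟩
  have key : ∀ n : ℕ, ∀ v : S, h v ≤ n →
      ∃ c : S, (G.induce S).Reachable v c ∧ (k : ℕ∞) ≤ (G.neighborSet c ∩ S).encard := by
    intro n
    induction n with
    | zero =>
      rintro v hv
      rcases hc v v.2 with h1 | ⟨u, hu, _, h2⟩
      · exact ⟨v, .refl _, h1⟩
      · omega
    | succ n ih =>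
      rintro v hv
      rcases hc v v.2 with h1 | ⟨u, hu, huv, h2⟩
      · exact ⟨v, .refl _, h1⟩
      · obtain ⟨c, hc1, hc2⟩ := ih ⟨u, hu⟩ (by simp; omega)
        refine ⟨c, Reachable.trans (Adj.reachable ?_) hc1, hc2⟩
        exact huv
  intro C
  obtain ⟨v, rfl⟩ := C.exists_rep
  obtain ⟨c, hvc, hk⟩ := key _ v le_rfl
  refine hk.trans ?_
  have hmem : ∀ x (hx : x ∈ G.neighborSet c ∩ S),
      (⟨x, hx.2⟩ : S) ∈ (G.induce S).connectedComponentMk v := by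
    intro x hx
    refine ConnectedComponent.sound (Reachable.symm (hvc.trans (Adj.reachable ?_)))
    exact hx.1
  have hcm : c ∈ (G.induce S).connectedComponentMk v :=
    ConnectedComponent.sound hvc.symm
  refine Set.encard_le_encard_of_injOn
    (f := fun x => if hx : x ∈ G.neighborSet c ∩ S then
      s(⟨c, hcm⟩, ⟨⟨x, hx.2⟩, hmem x hx⟩) else s(⟨c, hcm⟩, ⟨c, hcm⟩)) ?_ ?_
  · intro x hx
    simp only [hx, dite_true]
    exact hx.1
  · intro x hx y hy hxy
    simp only [hx, hy, dite_true] at hxy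
    have := Sym2.congr_right.1 hxy
    exact congrArg (fun z => (z.1.1 : V)) this

theorem IsStrongForest.of_rank (h : V → ℕ) (par : V → V)
    (H : ∀ v ∈ S, ∀ u ∈ S, G.Adj v u → h u ≤ h v → u = par v)
    (hc : ∀ v ∈ S, (k : ℕ∞) ≤ (G.neighborSet v ∩ S).encard ∨ ∃ u ∈ S, G.Adj v u ∧ h u < h v) :
    IsStrongForest G k S := by
  classical
  refine .of_isAcyclic ?_ h hc
  refine isAcyclic_of_rank (fun v => h v)
    (fun v => if hv : par v ∈ S then ⟨par v, hv⟩ else v) ?_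
  rintro ⟨v, hv⟩ ⟨u, hu⟩ hvu hle
  have := H v hv u hu hvu hle
  subst this
  simp [hu]

/-- The component of `v` cannot leave `W`, and it is a tree with at least `k` edges, hence at least
`k + 1` vertices. -/
theorem IsStrongForest.card_le [Finite V] (hS : IsStrongForest G k S) {W : Set V} {v : V}
    (hv : v ∈ S) (hvW : v ∈ W)
    (hW : ∀ x ∈ W, x ∈ S → ∀ y ∈ S, G.Adj x y → y ∈ W) : k + 1 ≤ (W ∩ S).ncard := by
  classical
  have := Fintype.ofFinite V
  let c := (G.induce S).connectedComponentMk ⟨v, hv⟩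
  have ht := hS.1.isTree_connectedComponent c
  have : Fintype c := Fintype.ofFinite _
  have : Fintype c.toSimpleGraph.edgeSet := Fintype.ofFinite _
  have h1 := ht.card_edgeFinset
  have h2 := hS.2 c
  rw [← coe_edgeFinset, Set.encard_coe_eq_coe_finsetCard] at h2
  have h2' : k ≤ c.toSimpleGraph.edgeFinset.card := by exact_mod_cast h2
  have hreach : ∀ x : S, (G.induce S).Reachable ⟨v, hv⟩ x → (x : V) ∈ W := by
    intro x hx
    obtain ⟨p⟩ := hx
    have : ∀ (a b : S) (p : (G.induce S).Walk a b), (a : V) ∈ W → (b : V) ∈ W := by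
      intro a b p
      induction p with
      | nil => exact id
      | cons hadj _ ih => exact fun ha => ih (hW _ ha (Subtype.coe_prop _) _ (Subtype.coe_prop _) hadj)
    exact this _ _ p hvW
  have h3 : Fintype.card c ≤ (W ∩ S).ncard := by
    rw [← Nat.card_eq_fintype_card, ← Nat.card_coe_set_eq]
    refine Nat.card_le_card_of_injective
      (fun x : c => (⟨x.1.1, hreach _ (ConnectedComponent.exact x.2).symm, x.1.2⟩ : ↥(W ∩ S))) ?_
    intro x y hxy
    exact Subtype.ext (Subtype.ext (congrArg (fun z : ↥(W ∩ S) => z.1) hxy))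
  omega

theorem exists_cover [Finite V] (G : SimpleGraph V) (k : ℕ) :
    ∃ t, ∃ F : Fin t → Set V, (∀ i, IsStrongForest G k (F i)) ∧
      ∀ e, IsValidEdge G k e → ∃ i, e ∈ inducedEdges G (F i) := by
  let e := Finite.equivFin {S // IsStrongForest G k S}
  refine ⟨_, fun i => (e.symm i).1, fun i => (e.symm i).2, ?_⟩
  rintro x ⟨S, hS, hx⟩
  exact ⟨e ⟨S, hS⟩, by simpa using hx⟩

theorem exists_cover_strongArboricity [Finite V] (G : SimpleGraph V) (k : ℕ) :
    ∃ F : Fin (strongArboricity G k) → Set V, (∀ i, IsStrongForest G k (F i)) ∧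
      ∀ e, IsValidEdge G k e → ∃ i, e ∈ inducedEdges G (F i) :=
  Nat.sInf_mem (exists_cover G k)

theorem le_strongArboricity [Finite V] {n : ℕ}
    (h : ∀ t (F : Fin t → Set V), (∀ i, IsStrongForest G k (F i)) →
      (∀ e, IsValidEdge G k e → ∃ i, e ∈ inducedEdges G (F i)) → n ≤ t) :
    n ≤ strongArboricity G k := by
  obtain ⟨F, h1, h2⟩ := exists_cover_strongArboricity G k
  exact h _ F h1 h2

theorem strongArboricity_le {t : ℕ} (F : Fin t → Set V) (h1 : ∀ i, IsStrongForest G k (F i))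
    (h2 : ∀ e, IsValidEdge G k e → ∃ i, e ∈ inducedEdges G (F i)) :
    strongArboricity G k ≤ t :=
  Nat.sInf_le ⟨F, h1, h2⟩

theorem strongArboricity_le_card {ι : Type*} [Finite ι] (F : ι → Set V)
    (h1 : ∀ i, IsStrongForest G k (F i))
    (h2 : ∀ e, IsValidEdge G k e → ∃ i, e ∈ inducedEdges G (F i)) :
    strongArboricity G k ≤ Nat.card ι := by
  let e := Finite.equivFin ι
  refine strongArboricity_le (fun i => F (e.symm i)) (fun i => h1 _) fun x hx => ?_
  obtain ⟨i, hi⟩ := h2 x hx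
  exact ⟨e i, by simpa using hi⟩

/-- Assigning to each edge a forest of the cover that contains it is injective. -/
theorem card_le_strongArboricity [Finite V] {ι : Type*} [Finite ι] (e : ι → Sym2 V)
    (hv : ∀ i, IsValidEdge G k (e i))
    (hc : ∀ S, IsStrongForest G k S → ∀ i j, e i ∈ inducedEdges G S → e j ∈ inducedEdges G S →
      i = j) : Nat.card ι ≤ strongArboricity G k := by
  refine le_strongArboricity fun t F h1 h2 => ?_
  choose g hg using fun i => h2 _ (hv i)
  have : Function.Injective g := by
    intro i j hij
    exact hc _ (h1 (g i)) i j (hg i) (hij ▸ hg j)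
  simpa using Nat.card_le_card_of_injective g this

end

theorem isStrongForest_image_iff {V W : Type*} {G : SimpleGraph V} {H : SimpleGraph W}
    (φ : H ↪g G) {k : ℕ} {S : Set W} :
    IsStrongForest G k (φ '' S) ↔ IsStrongForest H k S := by
  let e : H.induce S ≃g G.induce (φ '' S) :=
    { toEquiv := Equiv.Set.image φ S φ.injective
      map_rel_iff' := by rintro ⟨a, ha⟩ ⟨b, hb⟩; simp }
  unfold IsStrongForest
  rw [e.isAcyclic_iff]
  refine and_congr_right fun _ => ?_
  have key : ∀ c : (H.induce S).ConnectedComponent,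
      (e.connectedComponentEquiv c).toSimpleGraph.edgeSet.encard
        = c.toSimpleGraph.edgeSet.encard := by
    intro c
    let e' : c.toSimpleGraph ≃g (e.connectedComponentEquiv c).toSimpleGraph :=
      { toEquiv := ConnectedComponent.isoEquivSupp e c
        map_rel_iff' := by
          rintro ⟨a, ha⟩ ⟨b, hb⟩
          exact e.map_adj_iff }
    exact (Set.encard_congr e'.mapEdgeSet).symm
  rw [← e.connectedComponentEquiv.forall_congr_right]
  simp only [key]

/-- Here `F f` records the branch vertices in forest `f`, and `g i j m` is a forest covering a
chosen edge of the `m`-th path from `i` to `j`. -/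
theorem exists_pair_of_pigeonhole {t N M : ℕ} (hN : 2 ^ t < N) (hM : t < M)
    (F : Fin t → Set (Fin N)) (g : Fin N → Fin N → Fin M → Fin t) :
    ∃ i j, i ≠ j ∧ (∀ f, i ∈ F f ↔ j ∈ F f) ∧ ∃ m m', m ≠ m' ∧ g i j m = g i j m' := by
  classical
  obtain ⟨i, j, hij, hF⟩ := Fintype.exists_ne_map_eq_of_card_lt
    (fun i : Fin N => (fun f => decide (i ∈ F f) : Fin t → Bool)) (by simpa using hN)
  obtain ⟨m, m', hm, hg⟩ := Fintype.exists_ne_map_eq_of_card_lt (g i j) (by simpa using hM)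
  refine ⟨i, j, hij, fun f => ?_, m, m', hm, hg⟩
  simpa using congrFun hF f

end StrongArboricity

/-! ### Part (i): acyclic colourings and `f_1` -/

namespace StrongArboricity

open SimpleGraph

section

variable {V : Type*} {G : SimpleGraph V}

theorem isAcyclic_induce_of_subset {S T : Set V} (h : S ⊆ T) (hT : (G.induce T).IsAcyclic) :
    (G.induce S).IsAcyclic :=
  hT.embedding (G.induceHomOfLE h)

theorem encard_pair_le (a b : V) : ({a, b} : Set V).encard ≤ 2 :=
  (Set.encard_insert_le _ _).trans (by rw [Set.encard_singleton]; rfl)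

theorem acyclicChromaticNumber_le_card {α : Type*} [Finite α] (c : G.Coloring α)
    (hc : ∀ a b, (G.induce {v | c v = a ∨ c v = b}).IsAcyclic) :
    acyclicChromaticNumber G ≤ Nat.card α := by
  let e := Finite.equivFin α
  refine Nat.sInf_le ⟨Coloring.mk (fun v => e (c v)) fun h => e.injective.ne (c.valid h), ?_⟩
  intro a b
  refine isAcyclic_induce_of_subset ?_ (hc (e.symm a) (e.symm b))
  rintro v (h | h)
  · exact .inl ((Equiv.eq_symm_apply e).2 h)
  · exact .inr ((Equiv.eq_symm_apply e).2 h)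

theorem exists_acyclicColoring [Finite V] (G : SimpleGraph V) :
    ∃ c : G.Coloring (Fin (acyclicChromaticNumber G)),
      ∀ a b, (G.induce {v | c v = a ∨ c v = b}).IsAcyclic := by
  let e := Finite.equivFin V
  refine Nat.sInf_mem (s := {m | ∃ c : G.Coloring (Fin m),
    ∀ a b : Fin m, (G.induce {v | c v = a ∨ c v = b}).IsAcyclic}) ⟨_, Coloring.mk (fun v => e v)
      fun h => e.injective.ne h.ne, fun a b => IsAcyclic.of_card_le_two ?_⟩
  refine (Set.encard_le_encard (t := {e.symm a, e.symm b}) ?_).trans (encard_pair_le _ _)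
  rintro v (h | h)
  · exact Or.inl ((Equiv.eq_symm_apply e).2 h)
  · exact Or.inr ((Equiv.eq_symm_apply e).2 h)

theorem isValidEdge_one {u v : V} (h : G.Adj u v) : IsValidEdge G 1 s(u, v) := by
  refine ⟨{u, v}, .of_isAcyclic (.of_card_le_two (encard_pair_le u v)) (fun _ => 0) ?_, ?_⟩
  · rintro x (rfl | rfl) <;> left
    · exact Set.one_le_encard_iff_nonempty.2 ⟨v, h, by simp⟩
    · exact Set.one_le_encard_iff_nonempty.2 ⟨u, h.symm, by simp⟩
  · simp [mem_inducedEdges_iff, h]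

theorem acyclicChromaticNumber_le_pow [Finite V] (G : SimpleGraph V) :
    acyclicChromaticNumber G ≤ 3 ^ strongArboricity G 1 := by
  classical
  obtain ⟨F, hF, hcov⟩ := exists_cover_strongArboricity G 1
  have hC : ∀ i, Nonempty ((G.induce (F i)).Coloring (Fin 2)) := fun i => (hF i).1.colorable_two
  let C := fun i => (hC i).some
  let col : V → Fin (strongArboricity G 1) → Fin 3 :=
    fun v i => if h : v ∈ F i then (C i ⟨v, h⟩).succ else 0
  have hcol : ∀ v i, col v i ≠ 0 ↔ v ∈ F i := by
    intro v i
    by_cases h : v ∈ F i <;> simp [col, h]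
  have hedge : ∀ {u v}, G.Adj u v → ∃ i, u ∈ F i ∧ v ∈ F i := by
    intro u v h
    obtain ⟨i, hi⟩ := hcov _ (isValidEdge_one h)
    exact ⟨i, (mem_inducedEdges_iff.1 hi).2⟩
  let c : G.Coloring (Fin (strongArboricity G 1) → Fin 3) := Coloring.mk col (by
    intro u v h huv
    obtain ⟨i, hu, hv⟩ := hedge h
    have h1 := congrFun huv i
    simp only [col, hu, hv, dite_true, Fin.succ_inj] at h1
    exact (C i).valid (show (G.induce (F i)).Adj ⟨u, hu⟩ ⟨v, hv⟩ from h) h1)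
  have := acyclicChromaticNumber_le_card c ?_
  · simpa using this
  intro a b
  -- An edge between the two classes lies in some `F i`. Coordinate `i` is then nonzero on both
  -- classes, so both are contained in `F i`. Without such an edge the induced graph is empty.
  by_cases hE : ∃ u v, G.Adj u v ∧ (c u = a ∨ c u = b) ∧ (c v = a ∨ c v = b)
  · obtain ⟨u, v, h, hu, hv⟩ := hE
    obtain ⟨i, hui, hvi⟩ := hedge h
    refine isAcyclic_induce_of_subset ?_ (hF i).1
    have h1 : ∀ x, (c x = c u ∨ c x = c v) → x ∈ F i := by
      rintro x (hx | hx)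
      · exact (hcol x i).1 (by rw [show col x = col u from hx]; exact (hcol u i).2 hui)
      · exact (hcol x i).1 (by rw [show col x = col v from hx]; exact (hcol v i).2 hvi)
    have hne := c.valid h
    rintro x hx
    apply h1
    simp only [Set.mem_ofPred_eq] at hx
    grind
  · push Not at hE
    have : G.induce {v | c v = a ∨ c v = b} = ⊥ := by
      ext ⟨u, hu⟩ ⟨v, hv⟩
      simp only [Set.mem_ofPred_eq] at hu hv
      simp only [comap_adj, Function.Embedding.subtype_apply, bot_adj, iff_false]
      intro h
      have := hE u v h hu
      tauto
    rw [this]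
    exact isAcyclic_bot

/-- Discarding the isolated vertices of a two-coloured subgraph leaves an edge in every component
and loses no edge. -/
theorem strongArboricity_one_le_choose [Finite V] (G : SimpleGraph V) :
    strongArboricity G 1 ≤ (acyclicChromaticNumber G).choose 2 := by
  classical
  obtain ⟨c, hc⟩ := exists_acyclicColoring G
  let F : Finset.powersetCard 2 (Finset.univ : Finset (Fin (acyclicChromaticNumber G))) → Set V :=
    fun s => {v | c v ∈ s.1 ∧ ∃ u, c u ∈ s.1 ∧ G.Adj v u}
  have := strongArboricity_le_card (G := G) (k := 1) F ?_ ?_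
  · simpa using this
  · rintro ⟨s, hs⟩
    obtain ⟨a, b, -, rfl⟩ := Finset.card_eq_two.1 (Finset.mem_powersetCard.1 hs).2
    refine .of_isAcyclic (isAcyclic_induce_of_subset ?_ (hc a b)) (fun _ => 0) ?_
    · rintro v ⟨hv, -⟩
      simpa using hv
    · rintro v ⟨hv, u, hu, huv⟩
      exact .inl (Set.one_le_encard_iff_nonempty.2 ⟨u, huv, hu, v, hv, huv.symm⟩)
  · intro e he
    induction e with
    | _ u v =>
      obtain ⟨S, -, h⟩ := he
      have huv := (mem_inducedEdges_iff.1 h).1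
      refine ⟨⟨{c u, c v}, ?_⟩, mem_inducedEdges_iff.2 ⟨huv, ?_, ?_⟩⟩
      · simp [Finset.mem_powersetCard, Finset.card_pair (c.valid huv)]
      · exact ⟨by simp, v, by simp, huv⟩
      · exact ⟨by simp, u, by simp, huv.symm⟩

theorem logb_acyclicChromaticNumber_le [Finite V] (G : SimpleGraph V) :
    Real.logb 3 (acyclicChromaticNumber G : ℝ) ≤ (strongArboricity G 1 : ℝ) := by
  have h := acyclicChromaticNumber_le_pow G
  rcases Nat.eq_zero_or_pos (acyclicChromaticNumber G) with h0 | h0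
  -- By convention `Real.logb 3 0 = 0`, so the void case holds too.
  · simp [h0]
  · rw [Real.logb_le_iff_le_rpow (by norm_num) (by exact_mod_cast h0), Real.rpow_natCast]
    exact_mod_cast h

end

end StrongArboricity

/-! ### Items (a) and (c): subdivided multigraphs and starred complete graphs -/

namespace StrongArboricity

open SimpleGraph

/-- Vertices of the complete graph on `Fin N` with loops and all edges replaced by `M` paths of
length two for each ordered pair. -/
inductive SubdivVertex (N M : ℕ) : Type
  | branch (i : Fin N)
  | mid (i j : Fin N) (m : Fin M)

namespace SubdivVertex

variable {N M : ℕ}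

instance : Finite (SubdivVertex N M) :=
  Finite.of_injective (β := Fin N ⊕ Fin N × Fin N × Fin M)
    (fun v => match v with
      | branch i => .inl i
      | mid i j m => .inr (i, j, m)) (by
    rintro (_ | _) (_ | _) h <;> simp_all)

/-- The edges from a middle vertex to the first end of its path. -/
def fstRel : SubdivVertex N M → SubdivVertex N M → Prop
  | mid i _ _, branch a => a = i
  | _, _ => False

/-- The edges from a middle vertex to the second end of its path. -/
def sndRel : SubdivVertex N M → SubdivVertex N M → Prop
  | mid _ j _, branch a => a = j
  | _, _ => False

end SubdivVertex

open SubdivVertex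

/-- The complete multigraph with loops on `Fin N` with all edges subdivided once, each ordered pair
being joined by `M` edges. -/
def subdivGraph (N M : ℕ) : SimpleGraph (SubdivVertex N M) :=
  fromRel fstRel ⊔ fromRel sndRel

section

variable {N M : ℕ}

theorem isAcyclic_fromRel_fstRel : (fromRel (@fstRel N M)).IsAcyclic := by
  refine isAcyclic_of_rank (fun v => match v with | branch _ => 0 | mid _ _ _ => 1)
    (fun v => match v with | branch a => branch a | mid i _ _ => branch i) ?_
  rintro (_ | _) (_ | _) h <;> simp_all [fromRel_adj, fstRel]

theorem isAcyclic_fromRel_sndRel : (fromRel (@sndRel N M)).IsAcyclic := by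
  refine isAcyclic_of_rank (fun v => match v with | branch _ => 0 | mid _ _ _ => 1)
    (fun v => match v with | branch a => branch a | mid _ j _ => branch j) ?_
  rintro (_ | _) (_ | _) h <;> simp_all [fromRel_adj, sndRel]

@[simp] theorem subdivGraph_adj_mid {a i j : Fin N} {m : Fin M} :
    (subdivGraph N M).Adj (branch a) (mid i j m) ↔ a = i ∨ a = j := by
  simp [subdivGraph, fromRel_adj, fstRel, sndRel]

@[simp] theorem subdivGraph_mid_adj {a i j : Fin N} {m : Fin M} :
    (subdivGraph N M).Adj (mid i j m) (branch a) ↔ a = i ∨ a = j := by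
  simp [subdivGraph, fromRel_adj, fstRel, sndRel]

@[simp] theorem subdivGraph_not_adj_branch {a b : Fin N} :
    ¬ (subdivGraph N M).Adj (branch a) (branch b) := by
  simp [subdivGraph, fromRel_adj, fstRel, sndRel]

@[simp] theorem subdivGraph_not_adj_mid {i j i' j' : Fin N} {m m' : Fin M} :
    ¬ (subdivGraph N M).Adj (mid i j m) (mid i' j' m') := by
  simp [subdivGraph, fromRel_adj, fstRel, sndRel]

/-- The two edge relations are disjoint unions of stars around branch vertices; two parallel paths
form a square, which excludes a single forest. -/
theorem edgeArboricity_subdivGraph (hN : 2 ≤ N) (hM : 2 ≤ M) :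
    edgeArboricity (subdivGraph N M) = 2 := by
  refine le_antisymm (Nat.sInf_le ?_) (le_csInf ⟨2, ?_⟩ ?_)
  -- The same cover shows the upper bound and the nonemptiness required by `le_csInf`.
  iterate 2
    refine ⟨![fromRel fstRel, fromRel sndRel], ?_, ?_⟩
    · refine Fin.forall_fin_two.2 ⟨⟨le_sup_left, isAcyclic_fromRel_fstRel⟩,
        ⟨le_sup_right, isAcyclic_fromRel_sndRel⟩⟩
    · intro e he
      rw [subdivGraph, edgeSet_sup] at he
      exact he.elim (fun h => ⟨0, h⟩) (fun h => ⟨1, h⟩)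
  · rintro t ⟨F, hF, hcov⟩
    by_contra ht
    have hac : (subdivGraph N M).IsAcyclic := by
      have hsub : ∀ i j : Fin t, i = j := fun i j => Fin.ext (by omega)
      obtain ⟨f, -⟩ := hcov s(branch ⟨0, by omega⟩, mid ⟨0, by omega⟩ ⟨0, by omega⟩ ⟨0, by omega⟩)
        (by simp)
      refine (hF f).2.anti fun u v h => ?_
      obtain ⟨g, hg⟩ := hcov s(u, v) h
      rw [hsub f g]
      exact hg
    refine not_isAcyclic_of_square (a := branch (⟨0, by omega⟩ : Fin N))
      (c := branch (⟨1, by omega⟩ : Fin N))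
      (b := mid ⟨0, by omega⟩ ⟨1, by omega⟩ (⟨0, by omega⟩ : Fin M))
      (d := mid ⟨0, by omega⟩ ⟨1, by omega⟩ (⟨1, by omega⟩ : Fin M)) ?_ ?_ ?_ ?_ ?_ ?_ hac <;> simp

/-- The subdivided loops at `i` are `M` leaves of `branch i`, enough for a star that also contains
the given edge. -/
theorem isValidEdge_subdivGraph {k : ℕ} (hM : k ≤ M) (i j : Fin N) (m : Fin M) :
    IsValidEdge (subdivGraph N M) k s(branch i, mid i j m) := by
  refine ⟨{v | v = branch i ∨ v = mid i j m ∨ ∃ x, v = mid i i x}, ?_,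
    mem_inducedEdges_iff.2 ⟨by simp, by simp, by simp⟩⟩
  refine .of_rank (fun v => match v with | branch _ => 0 | mid _ _ _ => 1)
    (fun _ => branch i) ?_ ?_
  · rintro v hv (a | _) hu h
    · intro
      simpa using hu
    · rcases v with _ | _ <;> simp_all
  · rintro (a | _) hv
    · left
      have : a = i := by simpa using hv
      subst this
      exact le_encard_of_injective (by simpa using hM) (fun x => mid a a x)
        (fun x y h => by simpa using h) (fun x => ⟨by simp, by simp⟩)
    · exact .inr ⟨branch i, by simp, by
        simp only [Set.mem_ofPred_eq, reduceCtorEq, mid.injEq, false_or] at hv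
        rcases hv with hv | ⟨x, hv⟩ <;> simp [hv], by simp⟩

/-- A forest containing the first halves of two parallel paths from `i` to `j` also contains `branch
j` after the pigeonhole, and so a square. -/
theorem le_strongArboricity_subdivGraph (k n : ℕ) :
    n ≤ strongArboricity (subdivGraph (2 ^ n + 1) (n + k)) k := by
  refine le_strongArboricity fun t F hF hcov => ?_
  by_contra! ht
  choose g hg using fun i j m => hcov _ (isValidEdge_subdivGraph (N := 2 ^ n + 1) (M := n + k)
    (Nat.le_add_left k n) i j m)
  obtain ⟨i, j, hij, hF', m, m', hm, hgm⟩ := exists_pair_of_pigeonhole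
    (Nat.lt_succ_of_le (Nat.pow_le_pow_right two_pos ht.le)) (by omega)
    (fun f => {x | branch x ∈ F f}) g
  have h1 := mem_inducedEdges_iff.1 (hg i j m)
  have h2 := mem_inducedEdges_iff.1 (hg i j m')
  rw [← hgm] at h2
  have h3 : branch j ∈ F (g i j m) := (hF' _).1 h1.2.1
  refine not_isAcyclic_of_square (G := (subdivGraph _ _).induce (F (g i j m)))
    (a := ⟨_, h1.2.1⟩) (b := ⟨_, h1.2.2⟩) (c := ⟨_, h3⟩) (d := ⟨_, h2.2.2⟩)
    ?_ ?_ ?_ ?_ ?_ ?_ (hF _).1 <;> simp [hij, hm]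

/-- The complete graph on `Fin (N + 1)` with `q` leaves attached to the vertex `0`. -/
def starredCompleteGraph (q N : ℕ) : SimpleGraph (Fin q ⊕ Fin (N + 1)) :=
  fromRel fun
    | .inl _, .inr a => a = 0
    | .inr a, .inr b => a ≠ b
    | _, _ => False

/-- The leaves and one clique edge at `0` form a star with `q + 1` edges, but two clique edges at
`0` span a triangle. -/
theorem le_strongArboricity_starredCompleteGraph (q N : ℕ) :
    N ≤ strongArboricity (starredCompleteGraph q N) (q + 1) := by
  have := card_le_strongArboricity (G := starredCompleteGraph q N) (k := q + 1)
    (fun i : Fin N => s(.inr 0, .inr i.succ)) ?_ ?_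
  · simpa using this
  · intro i
    refine ⟨{v | v = .inr 0 ∨ v = .inr i.succ ∨ ∃ x, v = .inl x}, ?_,
      mem_inducedEdges_iff.2 ⟨?_, by simp, by simp⟩⟩
    · refine .of_rank (fun v => if v = .inr 0 then 0 else 1) (fun _ => .inr 0) ?_ ?_
      · rintro (v | v) hv (u | u) hu h hle <;>
          simp [starredCompleteGraph, fromRel_adj] at * <;> grind
      · intro v hv
        by_cases hv0 : v = .inr 0
        · left
          subst hv0
          refine le_encard_of_injective (ι := Option (Fin q)) (by simp)
            (fun x => match x with | none => .inr i.succ | some y => .inl y) ?_ ?_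
          · rintro (_ | x) (_ | y) h <;> simp_all
          · rintro (_ | x) <;>
              simp [starredCompleteGraph, fromRel_adj, Fin.succ_ne_zero, (Fin.succ_ne_zero _).symm]
        · right
          refine ⟨.inr 0, by simp, ?_, by simp [hv0]⟩
          rcases v with v | v <;> simp_all [starredCompleteGraph, fromRel_adj]
    · simp [starredCompleteGraph, fromRel_adj, (Fin.succ_ne_zero _).symm]
  · intro S hS i j hi hj
    by_contra hij
    have h1 := (mem_inducedEdges_iff.1 hi).2
    have h2 := (mem_inducedEdges_iff.1 hj).2
    refine not_isAcyclic_of_triangle (G := (starredCompleteGraph q N).induce S)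
      (a := ⟨_, h1.1⟩) (b := ⟨_, h1.2⟩) (c := ⟨_, h2.2⟩) ?_ ?_ ?_ hS.1 <;>
      simp [starredCompleteGraph, fromRel_adj, hij, (Fin.succ_ne_zero _).symm]

/-- An induced forest has at most two clique vertices and `q` leaves, hence at most `q + 1` edges.
-/
theorem strongArboricity_starredCompleteGraph_eq_zero (q N : ℕ) :
    strongArboricity (starredCompleteGraph q N) (q + 2) = 0 := by
  refine Nat.le_zero.1 (strongArboricity_le Fin.elim0 (fun i => i.elim0) ?_)
  rintro e ⟨S, hS, he⟩
  exfalso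
  induction e with
  | _ u v =>
    have h1 := (mem_inducedEdges_iff.1 he).2.1
    have h2 := hS.card_le (W := Set.univ) h1 trivial (fun _ _ _ _ _ _ => trivial)
    rw [Set.univ_inter] at h2
    have h3 : (Sum.inr ⁻¹' S : Set (Fin (N + 1))).ncard ≤ 2 := by
      by_contra! h
      obtain ⟨a, ha, b, hb, c, hc, hab, hac, hbc⟩ := (Set.two_lt_ncard (Set.toFinite _)).1 h
      refine not_isAcyclic_of_triangle (G := (starredCompleteGraph q N).induce S)
        (a := ⟨_, ha⟩) (b := ⟨_, hb⟩) (c := ⟨_, hc⟩) ?_ ?_ ?_ hS.1 <;>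
        simp [starredCompleteGraph, fromRel_adj, hab, hac, hbc, hab.symm, hac.symm, hbc.symm]
    have h4 : (Sum.inl ⁻¹' S : Set (Fin q)).ncard ≤ q := by
      simpa using Set.ncard_le_card (Sum.inl ⁻¹' S : Set (Fin q))
    have h5 : S ⊆ Sum.inl '' (Sum.inl ⁻¹' S) ∪ Sum.inr '' (Sum.inr ⁻¹' S) := by
      rintro (x | x) hx <;> simp [hx]
    have h6 := (Set.ncard_le_ncard h5).trans (Set.ncard_union_le _ _)
    rw [Set.ncard_image_of_injective _ Sum.inl_injective,
      Set.ncard_image_of_injective _ Sum.inr_injective] at h6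
    omega

end

end StrongArboricity

/-! ### Item (b): three `k`-strong forests, but many `(k+1)`-strong ones -/

namespace StrongArboricity

open SimpleGraph

/-- Vertices of the complete graph on `Fin N` with loops and all edges replaced by `M` paths of
length three for each ordered pair, where the second vertex of each path carries `q` leaves. -/
inductive GadgetVertex (N M q : ℕ) : Type
  | branch (i : Fin N)
  | fst (i j : Fin N) (m : Fin M)
  | snd (i j : Fin N) (m : Fin M)
  | leaf (i j : Fin N) (m : Fin M) (x : Fin q)

namespace GadgetVertex

variable {N M q : ℕ}

instance : Finite (GadgetVertex N M q) :=
  Finite.of_injective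
    (β := Fin N ⊕ (Fin N × Fin N × Fin M) ⊕ (Fin N × Fin N × Fin M) ⊕
      (Fin N × Fin N × Fin M × Fin q))
    (fun v => match v with
      | branch i => .inl i
      | fst i j m => .inr (.inl (i, j, m))
      | snd i j m => .inr (.inr (.inl (i, j, m)))
      | leaf i j m x => .inr (.inr (.inr (i, j, m, x)))) (by
    rintro (_ | _) (_ | _) h <;> simp_all)

/-- The adjacency relation of `gadgetGraph`. -/
def Adj : GadgetVertex N M q → GadgetVertex N M q → Prop
  | branch a, fst i _ _ => a = i
  | branch a, snd _ j _ => a = j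
  | fst i _ _, branch a => a = i
  | fst i j m, snd i' j' m' => i = i' ∧ j = j' ∧ m = m'
  | fst i j m, leaf i' j' m' _ => i = i' ∧ j = j' ∧ m = m'
  | snd _ j _, branch a => a = j
  | snd i j m, fst i' j' m' => i = i' ∧ j = j' ∧ m = m'
  | leaf i j m _, fst i' j' m' => i = i' ∧ j = j' ∧ m = m'
  | _, _ => False

end GadgetVertex

open GadgetVertex

/-- The complete multigraph with loops on `Fin N` with all edges subdivided twice, each ordered
pair being joined by `M` edges, and with `q` leaves at the first vertex of each subdivided edge. -/
def gadgetGraph (N M q : ℕ) : SimpleGraph (GadgetVertex N M q) where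
  Adj := GadgetVertex.Adj
  symm := ⟨by rintro (_ | _) (_ | _) <;> simp +contextual [GadgetVertex.Adj]⟩
  loopless := ⟨by rintro (_ | _) <;> simp [GadgetVertex.Adj]⟩

section

variable {N M q k : ℕ}

/-- Deleting the branch vertices leaves stars with `q + 1` edges: `q` leaves and one second vertex.
-/
theorem isStrongForest_gadgets (hq : k ≤ q + 1) :
    IsStrongForest (gadgetGraph N M q) k {v | ∀ a, v ≠ branch a} := by
  refine .of_rank (fun v => match v with | fst _ _ _ => 0 | _ => 1)
    (fun v => match v with | snd i j m => fst i j m | leaf i j m _ => fst i j m | v => v) ?_ ?_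
  · rintro (_ | _) hv (_ | _) hu h hle <;> simp [gadgetGraph, GadgetVertex.Adj] at * <;> tauto
  · rintro (_ | ⟨i, j, m⟩ | ⟨i, j, m⟩ | ⟨i, j, m, x⟩) hv
    · simp at hv
    · left
      refine le_encard_of_injective (ι := Option (Fin q)) (by simpa using hq)
        (fun x => match x with | none => snd i j m | some y => leaf i j m y) ?_ ?_
      · rintro (_ | x) (_ | y) h <;> simp_all
      · rintro (_ | x) <;> simp [gadgetGraph, GadgetVertex.Adj]
    · exact .inr ⟨fst i j m, by simp, by simp [gadgetGraph, GadgetVertex.Adj], by simp⟩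
    · exact .inr ⟨fst i j m, by simp, by simp [gadgetGraph, GadgetVertex.Adj], by simp⟩

theorem isStrongForest_branch_fst (hNM : k ≤ N * M) :
    IsStrongForest (gadgetGraph N M q) k {v | (∃ a, v = branch a) ∨ ∃ i j m, v = fst i j m} := by
  refine .of_rank (fun v => match v with | branch _ => 0 | _ => 1)
    (fun v => match v with | fst i _ _ => branch i | v => v) ?_ ?_
  · rintro (_ | _) hv (_ | _) hu h hle <;> simp [gadgetGraph, GadgetVertex.Adj] at * <;> tauto
  · rintro (a | ⟨i, j, m⟩ | ⟨i, j, m⟩ | ⟨i, j, m, x⟩) hv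
    · left
      refine le_encard_of_injective (ι := Fin N × Fin M) (by simpa using hNM)
        (fun x => fst a x.1 x.2) ?_ ?_
      · rintro ⟨x, y⟩ ⟨x', y'⟩ h
        simpa using h
      · simp [gadgetGraph, GadgetVertex.Adj]
    · exact .inr ⟨branch i, by simp, by simp [gadgetGraph, GadgetVertex.Adj], by simp⟩
    · simp at hv
    · simp at hv

theorem isStrongForest_branch_snd (hNM : k ≤ N * M) :
    IsStrongForest (gadgetGraph N M q) k {v | (∃ a, v = branch a) ∨ ∃ i j m, v = snd i j m} := by
  refine .of_rank (fun v => match v with | branch _ => 0 | _ => 1)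
    (fun v => match v with | snd _ j _ => branch j | v => v) ?_ ?_
  · rintro (_ | _) hv (_ | _) hu h hle <;> simp [gadgetGraph, GadgetVertex.Adj] at * <;> tauto
  · rintro (a | ⟨i, j, m⟩ | ⟨i, j, m⟩ | ⟨i, j, m, x⟩) hv
    · left
      refine le_encard_of_injective (ι := Fin N × Fin M) (by simpa using hNM)
        (fun x => snd x.1 a x.2) ?_ ?_
      · rintro ⟨x, y⟩ ⟨x', y'⟩ h
        simpa using h
      · simp [gadgetGraph, GadgetVertex.Adj]
    · simp at hv
    · exact .inr ⟨branch j, by simp, by simp [gadgetGraph, GadgetVertex.Adj], by simp⟩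
    · simp at hv

theorem strongArboricity_gadgetGraph_le (hq : k ≤ q + 1) (hNM : k ≤ N * M) :
    strongArboricity (gadgetGraph N M q) k ≤ 3 := by
  refine strongArboricity_le
    ![{v | ∀ a, v ≠ branch a}, {v | (∃ a, v = branch a) ∨ ∃ i j m, v = fst i j m},
      {v | (∃ a, v = branch a) ∨ ∃ i j m, v = snd i j m}]
    (Fin.forall_fin_succ.2 ⟨isStrongForest_gadgets hq, Fin.forall_fin_two.2
      ⟨isStrongForest_branch_fst hNM, isStrongForest_branch_snd hNM⟩⟩) ?_
  intro e he
  induction e with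
  | _ u v =>
    obtain ⟨S, -, h⟩ := he
    have h := (mem_inducedEdges_iff.1 h).1
    simp only [mem_inducedEdges_iff, h, true_and, Fin.exists_fin_succ]
    rcases u with _ | _ <;> rcases v with _ | _ <;> simp [gadgetGraph, GadgetVertex.Adj] at *

/-- The star at `fst i j m` with `branch i` has `q + 2` edges. For `i = j` it would not be induced,
as a twice subdivided loop is a triangle. -/
theorem isValidEdge_gadgetGraph {i j : Fin N} (hij : i ≠ j) (m : Fin M) :
    IsValidEdge (gadgetGraph N M q) (q + 2) s(fst i j m, snd i j m) := by
  refine ⟨{v | v = branch i ∨ v = fst i j m ∨ v = snd i j m ∨ ∃ x, v = leaf i j m x}, ?_,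
    mem_inducedEdges_iff.2 ⟨by simp [gadgetGraph, GadgetVertex.Adj], by simp, by simp⟩⟩
  refine .of_rank (fun v => match v with | fst _ _ _ => 0 | _ => 1) (fun _ => fst i j m) ?_ ?_
  · rintro (_ | _) hv (_ | _) hu h hle <;> simp [gadgetGraph, GadgetVertex.Adj] at * <;> grind
  · rintro v hv
    by_cases hf : v = fst i j m
    · left
      subst hf
      refine le_encard_of_injective (ι := Option (Option (Fin q))) (by simp)
        (fun x => match x with
          | none => branch i | some none => snd i j m | some (some y) => leaf i j m y) ?_ ?_
      · rintro (_ | _ | x) (_ | _ | y) h <;> simp_all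
      · rintro (_ | _ | x) <;> simp [gadgetGraph, GadgetVertex.Adj]
    · right
      refine ⟨fst i j m, by simp, ?_, ?_⟩ <;>
        rcases hv with rfl | rfl | rfl | ⟨x, rfl⟩ <;> simp [gadgetGraph, GadgetVertex.Adj] at *

/-- Without both ends of the path, the component has at most `q + 2` vertices, one too few. -/
theorem branch_mem_of_isStrongForest {S : Set (GadgetVertex N M q)} {i j : Fin N} {m : Fin M}
    (hS : IsStrongForest (gadgetGraph N M q) (q + 2) S) (h : fst i j m ∈ S) :
    branch i ∈ S ∨ branch j ∈ S := by
  by_contra! hb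
  have h1 := hS.card_le (W := {fst i j m, snd i j m} ∪ Set.range (leaf i j m)) h (by simp) ?_
  · have h2 := h1.trans (Set.ncard_le_ncard Set.inter_subset_left)
    have h3 := h2.trans (Set.ncard_union_le _ _)
    have h4 : ({fst i j m, snd i j m} : Set (GadgetVertex N M q)).ncard ≤ 2 :=
      (Set.ncard_insert_le _ _).trans (by simp)
    have h5 : (Set.range (leaf i j m : Fin q → GadgetVertex N M q)).ncard ≤ q := by
      rw [← Set.image_univ]
      exact (Set.ncard_image_le).trans (by simp)
    omega
  · rintro (_ | _) hx hxS (_ | _) hyS hadj <;>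
      simp_all [gadgetGraph, GadgetVertex.Adj]

/-- A forest covering a middle edge contains one end of its path; after the pigeonhole it contains
both ends, and two such paths form a hexagon. -/
theorem le_strongArboricity_gadgetGraph {n M : ℕ} (hM : n ≤ M) (q : ℕ) :
    n ≤ strongArboricity (gadgetGraph (2 ^ n + 1) (M + 1) q) (q + 2) := by
  refine le_strongArboricity fun t F hF hcov => ?_
  by_contra! ht
  -- Provides a default value for `g` when `i = j`.
  have ht0 : 0 < t := by
    obtain ⟨f, -⟩ := hcov _ (isValidEdge_gadgetGraph (i := 0) (j := Fin.last _)
      (by simp [Fin.ext_iff, eq_comm]) 0)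
    exact f.pos
  have hg : ∀ i j m, ∃ f : Fin t, i ≠ j →
      s(fst i j m, snd i j m) ∈ inducedEdges (gadgetGraph (2 ^ n + 1) (M + 1) q) (F f) := by
    intro i j m
    by_cases hij : i = j
    · exact ⟨⟨0, ht0⟩, fun h => (h hij).elim⟩
    · obtain ⟨f, hf⟩ := hcov _ (isValidEdge_gadgetGraph hij m)
      exact ⟨f, fun _ => hf⟩
  choose g hg using hg
  obtain ⟨i, j, hij, hF', m, m', hm, hgm⟩ := exists_pair_of_pigeonhole
    (Nat.lt_succ_of_le (Nat.pow_le_pow_right two_pos ht.le)) (by omega)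
    (fun f => {x | branch x ∈ F f}) g
  have h1 := mem_inducedEdges_iff.1 (hg i j m hij)
  have h2 := mem_inducedEdges_iff.1 (hg i j m' hij)
  rw [← hgm] at h2
  have hF'' : branch i ∈ F (g i j m) ↔ branch j ∈ F (g i j m) := hF' _
  have h3 := branch_mem_of_isStrongForest (hF _) h1.2.1
  have h4 : branch i ∈ F (g i j m) := by tauto
  have h5 : branch j ∈ F (g i j m) := by tauto
  refine not_isAcyclic_of_hexagon (G := (gadgetGraph _ _ _).induce (F (g i j m)))
    (u := ⟨_, h4⟩) (s := ⟨_, h1.2.1⟩) (s' := ⟨_, h1.2.2⟩) (v := ⟨_, h5⟩)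
    (t := ⟨_, h2.2.1⟩) (t' := ⟨_, h2.2.2⟩)
    ?_ ?_ ?_ ?_ ?_ ?_ ?_ ?_ ?_ ?_ ?_ ?_ (hF _).1 <;>
      simp [gadgetGraph, GadgetVertex.Adj, hij, hm]

end

end StrongArboricity

/-! ### Tree-width and tree-depth bounds from a triangle -/

namespace StrongArboricity

open SimpleGraph

theorem exists_isPath_of_rank {V : Type*} {G : SimpleGraph V} (h : V → ℕ) (c : V)
    (hc : ∀ v, v = c ∨ ∃ u, G.Adj v u ∧ h u < h v) (v : V) :
    ∃ p : G.Walk v c, p.IsPath ∧ p.length ≤ h v := by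
  classical
  suffices H : ∀ n v, h v ≤ n → ∃ p : G.Walk v c, p.length ≤ h v by
    obtain ⟨p, hp⟩ := H _ v le_rfl
    exact ⟨p.bypass, p.bypass_isPath, p.length_bypass_le_length.trans hp⟩
  intro n
  induction n with
  | zero =>
    intro v hv
    rcases hc v with rfl | ⟨u, -, hu⟩
    · exact ⟨.nil, by simp⟩
    · omega
  | succ n ih =>
    intro v hv
    rcases hc v with rfl | ⟨u, huv, hu⟩
    · exact ⟨.nil, by simp⟩
    · obtain ⟨p, hp⟩ := ih u (by omega)
      exact ⟨.cons huv p, by simp; omega⟩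

theorem connected_of_rank {V : Type*} {G : SimpleGraph V} (h : V → ℕ) (c : V)
    (hc : ∀ v, v = c ∨ ∃ u, G.Adj v u ∧ h u < h v) : G.Connected :=
  (connected_iff_exists_forall_reachable G).2 ⟨c, fun v =>
    let ⟨p, _⟩ := exists_isPath_of_rank h c hc v
    ⟨p.reverse⟩⟩

theorem connected_induce_of_rank {V : Type*} {G : SimpleGraph V} (h : V → ℕ) {S : Set V} {c : V}
    (hcS : c ∈ S) (hc : ∀ v ∈ S, v = c ∨ ∃ u ∈ S, G.Adj v u ∧ h u < h v) :
    (G.induce S).Connected := by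
  refine connected_of_rank (fun v => h v) ⟨c, hcS⟩ ?_
  rintro ⟨v, hv⟩
  rcases hc v hv with rfl | ⟨u, hu, huv, hlt⟩
  · exact .inl rfl
  · exact .inr ⟨⟨u, hu⟩, huv, hlt⟩

theorem isRootedTreeOfDepthLE_of_rank {V : Type*} {T : SimpleGraph V} (h : V → ℕ) (par : V → V)
    {r : V} {d : ℕ} (H : ∀ v u, T.Adj v u → h u ≤ h v → u = par v)
    (hc : ∀ v, v = r ∨ ∃ u, T.Adj v u ∧ h u < h v) (hd : ∀ v, h v < d) :
    IsRootedTreeOfDepthLE T r d := by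
  have hac := isAcyclic_of_rank h par H
  refine ⟨⟨connected_of_rank h r hc, hac⟩, fun u p hp => ?_⟩
  obtain ⟨q, hq, hl⟩ := exists_isPath_of_rank h r hc u
  have : p = q := congrArg Subtype.val ((hac.subsingleton_path u r).elim ⟨p, hp⟩ ⟨q, hq⟩)
  rw [this, Walk.length_support]
  exact hl.trans_lt (hd u)

theorem exists_isPath_of_connected_induce {V : Type*} {G : SimpleGraph V} {S : Set V}
    (hS : (G.induce S).Connected) {a b : V} (ha : a ∈ S) (hb : b ∈ S) :
    ∃ p : G.Walk a b, p.IsPath ∧ ∀ x ∈ p.support, x ∈ S := by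
  obtain ⟨p, hp⟩ := hS.exists_isPath ⟨a, ha⟩ ⟨b, hb⟩
  refine ⟨p.map (Embedding.induce S).toHom, hp.map Subtype.val_injective, ?_⟩
  intro x hx
  obtain ⟨y, -, rfl⟩ := List.mem_map.1
    ((congrArg (x ∈ ·) (Walk.support_map (Embedding.induce S).toHom p)).mp hx)
  exact y.2

/-- The Helly property of three subtrees of a forest. -/
theorem nonempty_inter_of_connected_induce {V : Type*} {T : SimpleGraph V} (hT : T.IsAcyclic)
    {A B C : Set V} (hA : (T.induce A).Connected) (hB : (T.induce B).Connected)
    (hC : (T.induce C).Connected) (hAB : (A ∩ B).Nonempty) (hBC : (B ∩ C).Nonempty)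
    (hAC : (A ∩ C).Nonempty) : ∃ x, x ∈ A ∧ x ∈ B ∧ x ∈ C := by
  classical
  obtain ⟨x, hxA, hxB⟩ := hAB
  obtain ⟨y, hyB, hyC⟩ := hBC
  obtain ⟨z, hzA, hzC⟩ := hAC
  obtain ⟨r, hr, hrB⟩ := exists_isPath_of_connected_induce hB hxB hyB
  clear hyB hxB
  induction r with
  | nil => exact ⟨_, hxA, hrB _ (by simp), hyC⟩
  | @cons x x' y hadj r ih =>
    by_cases hxC : x ∈ C
    · exact ⟨x, hxA, hrB _ (by simp), hxC⟩
    · by_cases hx'A : x' ∈ A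
      · exact ih hx'A hyC hr.of_cons fun w hw => hrB w (by simp [hw])
      -- There are two routes from `x'` to `z`: through `x` and inside `A`, or along `r` and then
      -- inside `C`. Uniqueness of paths puts `x` on the second, but `x` is neither on `r` nor in
      -- `C`.
      · exfalso
        obtain ⟨s, hs, hsA⟩ := exists_isPath_of_connected_induce hA hxA hzA
        obtain ⟨t, -, htC⟩ := exists_isPath_of_connected_induce hC hyC hzC
        have h1 : (Walk.cons hadj.symm s).IsPath :=
          Walk.cons_isPath_iff _ _ |>.2 ⟨hs, fun h => hx'A (hsA _ h)⟩
        have h2 := congrArg Subtype.val ((hT.subsingleton_path x' z).elim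
          ⟨_, h1⟩ ⟨_, (r.append t).bypass_isPath⟩)
        have h3 : x ∈ (r.append t).support := by
          refine (r.append t).support_bypass_subset_support ?_
          rw [← show _ = (r.append t).bypass from h2]
          simp
        rw [Walk.mem_support_append_iff] at h3
        rcases h3 with h3 | h3
        · exact ((Walk.cons_isPath_iff _ _).1 hr).2 h3
        · exact hxC (htC _ h3)

/-- By the Helly property some node of the tree belongs to all three sets. -/
theorem le_treeWidth_of_triangle {V : Type*} {G : SimpleGraph V} {a b c : V} (hab : G.Adj a b)
    (hbc : G.Adj b c) (hac : G.Adj a c) {w : ℕ} {ι : Type*} {T : SimpleGraph ι} {B : V → Set ι}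
    (hTB : IsTreeDecomposition G T B) (hw : ∀ x : ι, {v | x ∈ B v}.encard ≤ (w : ℕ∞) + 1) :
    2 ≤ w := by
  obtain ⟨x, ha, hb, hc⟩ := nonempty_inter_of_connected_induce hTB.1.2 (hTB.2.1 a).2 (hTB.2.1 b).2
    (hTB.2.1 c).2 (hTB.2.2 _ _ hab) (hTB.2.2 _ _ hbc) (hTB.2.2 _ _ hac)
  have h1 : (3 : ℕ∞) ≤ {v | x ∈ B v}.encard := by
    refine le_encard_of_injective (k := 3) (ι := Fin 3) (by simp) ![a, b, c] ?_ ?_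
    · intro i j
      fin_cases i <;> fin_cases j <;> simp [hab.ne, hbc.ne, hac.ne, hab.ne', hbc.ne', hac.ne']
    · intro i
      fin_cases i <;> simpa
  have h2 := h1.trans (hw x)
  have h3 : 3 ≤ w + 1 := by exact_mod_cast h2
  omega

/-- In a closure of depth at most two every edge meets the root, while a triangle always has an edge
avoiding it. -/
theorem le_treeDepth_of_triangle {V : Type*} {G : SimpleGraph V} {a b c : V} (hab : G.Adj a b)
    (hbc : G.Adj b c) (hac : G.Adj a c) {d : ℕ} (hd : ∀ c : G.ConnectedComponent,
      ∃ (ι : Type) (_ : Finite ι) (T : SimpleGraph ι) (r : ι),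
        IsRootedTreeOfDepthLE T r d ∧ c.toSimpleGraph.IsContained (rootedClosure T r)) :
    3 ≤ d := by
  obtain ⟨ι, -, T, r, hT, ⟨f⟩⟩ := hd (G.connectedComponentMk a)
  by_contra! hd
  have key : ∀ u v, (rootedClosure T r).Adj u v → u = r ∨ v = r := by
    have : ∀ u v, u ≠ v → (∃ p : T.Walk u r, p.IsPath ∧ v ∈ p.support) → u = r ∨ v = r := by
      rintro u v huv ⟨p, hp, hv⟩
      have hl := hT.2 u p hp
      cases p with
      | nil => exact .inl rfl
      | cons h p =>
        cases p with
        | nil => simp_all; tauto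
        | cons h p => simp at hl; omega
    rintro u v ⟨huv, h | h⟩
    · exact this _ _ huv h
    · exact (this _ _ huv.symm h).symm
  let a' : G.connectedComponentMk a := ⟨a, rfl⟩
  let b' : G.connectedComponentMk a := ⟨b, ConnectedComponent.sound hab.symm.reachable⟩
  let c' : G.connectedComponentMk a := ⟨c, ConnectedComponent.sound hac.symm.reachable⟩
  have h1 := (f.toHom.map_rel (show (G.connectedComponentMk a).toSimpleGraph.Adj a' b' from hab))
  have h2 := (f.toHom.map_rel (show (G.connectedComponentMk a).toSimpleGraph.Adj b' c' from hbc))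
  have h3 := (f.toHom.map_rel (show (G.connectedComponentMk a).toSimpleGraph.Adj a' c' from hac))
  have k1 := key _ _ h1
  have k2 := key _ _ h2
  have k3 := key _ _ h3
  have n1 := h1.ne
  have n2 := h2.ne
  have n3 := h3.ne
  grind

theorem one_le_strongArboricity {V : Type*} [Finite V] {G : SimpleGraph V} {k : ℕ} {e : Sym2 V}
    (he : IsValidEdge G k e) : 1 ≤ strongArboricity G k := by
  simpa using card_le_strongArboricity (ι := Unit) (fun _ => e) (fun _ => he)
    (fun _ _ _ _ _ _ => rfl)

/-- Any two edges of a triangle span the third, so no induced forest contains two of them. -/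
theorem three_le_strongArboricity_of_triangle {V : Type*} [Finite V] {G : SimpleGraph V} {k : ℕ}
    {a b c : V} (hab : IsValidEdge G k s(a, b)) (hbc : IsValidEdge G k s(b, c))
    (hac : IsValidEdge G k s(a, c)) : 3 ≤ strongArboricity G k := by
  have key : ∀ {u v}, IsValidEdge G k s(u, v) → G.Adj u v := by
    rintro u v ⟨S, -, h⟩
    exact (mem_inducedEdges_iff.1 h).1
  have ht : ∀ S, IsStrongForest G k S → ¬ (a ∈ S ∧ b ∈ S ∧ c ∈ S) := by
    rintro S hS ⟨ha, hb, hc⟩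
    exact not_isAcyclic_of_triangle (G := G.induce S) (a := ⟨a, ha⟩) (b := ⟨b, hb⟩) (c := ⟨c, hc⟩)
      (key hab) (key hbc) (key hac) hS.1
  have := card_le_strongArboricity (G := G) (k := k) ![s(a, b), s(b, c), s(a, c)] ?_ ?_
  · simpa using this
  · intro i
    fin_cases i <;> assumption
  · intro S hS i j hi hj
    have := ht S hS
    fin_cases i <;> fin_cases j <;> simp [mem_inducedEdges_iff] at * <;> tauto

theorem strongArboricity_le_of_iso {V W : Type*} [Finite V] {G : SimpleGraph V}
    {H : SimpleGraph W} (φ : H ≃g G) (k : ℕ) : strongArboricity H k ≤ strongArboricity G k := by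
  obtain ⟨F, hF, hcov⟩ := exists_cover_strongArboricity G k
  have himg : ∀ S, φ.toEmbedding '' (φ ⁻¹' S) = S := fun S => Set.image_preimage_eq S φ.surjective
  refine strongArboricity_le (fun i => φ ⁻¹' F i) (fun i => ?_) ?_
  · rw [← isStrongForest_image_iff φ.toEmbedding, himg]
    exact hF i
  · rintro e ⟨S, hS, he⟩
    induction e with
    | _ u v =>
      have h := mem_inducedEdges_iff.1 he
      obtain ⟨i, hi⟩ := hcov s(φ u, φ v) ⟨φ.toEmbedding '' S, (isStrongForest_image_iff _).2 hS,
        mem_inducedEdges_iff.2 ⟨φ.map_adj_iff.2 h.1, ⟨u, h.2.1, rfl⟩, ⟨v, h.2.2, rfl⟩⟩⟩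
      exact ⟨i, mem_inducedEdges_iff.2 ⟨h.1, (mem_inducedEdges_iff.1 hi).2⟩⟩

end StrongArboricity

/-! ### Items (d) and (e): the fan graph and its pendant extension -/

namespace StrongArboricity

open SimpleGraph

/-- Vertices of `fanGraph`. -/
inductive FanVertex (q : ℕ) : Type
  | root
  | apex
  | tip
  | mid (i : Fin (q + 1))
  | leaf (x : Fin (q + 2))

namespace FanVertex

variable {q : ℕ}

instance : Finite (FanVertex q) :=
  Finite.of_injective (β := Fin 3 ⊕ Fin (q + 1) ⊕ Fin (q + 2))
    (fun v => match v with
      | root => .inl 0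
      | apex => .inl 1
      | tip => .inl 2
      | mid i => .inr (.inl i)
      | leaf x => .inr (.inr x)) (by
    rintro (_ | _) (_ | _) h <;> simp_all)

/-- The adjacency relation of `fanGraph`. -/
def Adj : FanVertex q → FanVertex q → Prop
  | root, mid _ => True
  | mid _, root => True
  | root, leaf _ => True
  | leaf _, root => True
  | apex, mid _ => True
  | mid _, apex => True
  | apex, tip => True
  | tip, apex => True
  | tip, mid i => i = 0
  | mid i, tip => i = 0
  | _, _ => False

/-- The adjacency relation of `fanTree`. -/
def TreeAdj : FanVertex q → FanVertex q → Prop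
  | root, mid _ => True
  | mid _, root => True
  | root, leaf _ => True
  | leaf _, root => True
  | apex, root => True
  | root, apex => True
  | tip, mid i => i = 0
  | mid i, tip => i = 0
  | _, _ => False

/-- The distance from `root` in `fanTree`. -/
def rank : FanVertex q → ℕ
  | root => 0
  | tip => 2
  | _ => 1

/-- The parent of a vertex in `fanTree`. -/
def par : FanVertex q → FanVertex q
  | tip => mid 0
  | _ => root

/-- The bags of a tree decomposition of `fanGraph` along `fanTree`. -/
def bag : FanVertex q → Set (FanVertex q)
  | root => {v | v ≠ apex ∧ v ≠ tip}
  | apex => {v | ∀ x, v ≠ leaf x}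
  | tip => {tip}
  | mid i => {v | v = mid i ∨ i = 0 ∧ v = tip}
  | leaf x => {leaf x}

end FanVertex

open FanVertex

/-- The complete bipartite graph `K_{2, q+1}`, with a triangle attached to one of its edges and with
`q + 2` leaves attached to the vertex of degree `q + 1` that is not in the triangle. -/
def fanGraph (q : ℕ) : SimpleGraph (FanVertex q) where
  Adj := FanVertex.Adj
  symm := ⟨by rintro (_ | _) (_ | _) <;> simp [FanVertex.Adj]⟩
  loopless := ⟨by rintro (_ | _) <;> simp [FanVertex.Adj]⟩

/-- The tree of a tree decomposition of `fanGraph`. -/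
def fanTree (q : ℕ) : SimpleGraph (FanVertex q) where
  Adj := FanVertex.TreeAdj
  symm := ⟨by rintro (_ | _) (_ | _) <;> simp [FanVertex.TreeAdj]⟩
  loopless := ⟨by rintro (_ | _) <;> simp [FanVertex.TreeAdj]⟩

section

variable {q : ℕ}

theorem isValidEdge_fanGraph_tip : IsValidEdge (fanGraph q) (q + 2) s(tip, mid 0) := by
  refine ⟨{v | v = root ∨ v = tip ∨ v = mid 0 ∨ ∃ x, v = leaf x}, ?_,
    mem_inducedEdges_iff.2 ⟨by simp [fanGraph, FanVertex.Adj], by simp, by simp⟩⟩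
  refine .of_rank rank par ?_ ?_
  · rintro (_ | _) hv (_ | _) hu h hle <;> simp [fanGraph, FanVertex.Adj, rank, par] at * <;> tauto
  · rintro (_ | _ | _ | i | x) hv
    · exact .inl (le_encard_of_injective (ι := Fin (q + 2)) (by simp) leaf
        (fun _ _ h => by simpa using h) (fun x => by simp [fanGraph, FanVertex.Adj]))
    · simp at hv
    · exact .inr ⟨mid 0, by simp, by simp [fanGraph, FanVertex.Adj], by simp [rank]⟩
    · exact .inr ⟨root, by simp, by simp [fanGraph, FanVertex.Adj], by simp [rank]⟩
    · exact .inr ⟨root, by simp, by simp [fanGraph, FanVertex.Adj], by simp [rank]⟩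

theorem isValidEdge_fanGraph_apex (i : Fin (q + 1)) :
    IsValidEdge (fanGraph q) (q + 2) s(apex, mid i) := by
  refine ⟨{v | v = root ∨ v = apex ∨ v = mid i ∨ ∃ x, v = leaf x}, ?_,
    mem_inducedEdges_iff.2 ⟨by simp [fanGraph, FanVertex.Adj], by simp, by simp⟩⟩
  refine .of_rank (fun v => match v with | root => 0 | apex => 2 | _ => 1)
    (fun v => match v with | apex => mid i | _ => root) ?_ ?_
  · rintro (_ | _) hv (_ | _) hu h hle <;> simp [fanGraph, FanVertex.Adj] at * <;> tauto
  · rintro (_ | _ | _ | i | x) hv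
    · exact .inl (le_encard_of_injective (ι := Fin (q + 2)) (by simp) leaf
        (fun _ _ h => by simpa using h) (fun x => by simp [fanGraph, FanVertex.Adj]))
    · exact .inr ⟨mid i, by simp, by simp [fanGraph, FanVertex.Adj], by simp⟩
    · simp at hv
    · exact .inr ⟨root, by simp, by simp [fanGraph, FanVertex.Adj], by simp⟩
    · exact .inr ⟨root, by simp, by simp [fanGraph, FanVertex.Adj], by simp⟩

/-- Without `root`, the component lies among the `q + 3` vertices `apex`, `tip` and `mid i`. It
needs that many, so it contains them all, including a triangle. -/
theorem root_mem_of_isStrongForest_fanGraph {S : Set (FanVertex q)}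
    (hS : IsStrongForest (fanGraph q) (q + 2) S) {i : Fin (q + 1)} (hi : mid i ∈ S) :
    root ∈ S := by
  by_contra hr
  let W : Set (FanVertex q) := {apex, tip} ∪ Set.range mid
  have h1 := hS.card_le (W := W) hi (by simp [W]) (by
    rintro (_ | _) hx hxS (_ | _) hyS hadj <;> simp_all [fanGraph, FanVertex.Adj, W])
  have h4 : ({apex, tip} : Set (FanVertex q)).ncard ≤ 2 :=
    (Set.ncard_insert_le _ _).trans (by simp)
  have h5 : (Set.range (mid : Fin (q + 1) → FanVertex q)).ncard ≤ q + 1 := by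
    rw [← Set.image_univ]
    exact (Set.ncard_image_le).trans (by simp)
  have h6 : W.ncard ≤ (W ∩ S).ncard := by
    have := Set.ncard_union_le {apex, tip} (Set.range (mid : Fin (q + 1) → FanVertex q))
    change W.ncard ≤ _ at this
    omega
  have h7 : W ⊆ S := Set.inter_eq_left.1 (Set.eq_of_subset_of_ncard_le Set.inter_subset_left h6)
  refine not_isAcyclic_of_triangle (G := (fanGraph q).induce S) (a := ⟨apex, h7 (by simp [W])⟩)
    (b := ⟨tip, h7 (by simp [W])⟩) (c := ⟨mid 0, h7 (by simp [W])⟩) ?_ ?_ ?_ hS.1 <;>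
    simp [fanGraph, FanVertex.Adj]

/-- Two edges at `apex` close a square through the forced `root`; the extra edge at `tip` closes a
triangle with any of them. -/
theorem le_strongArboricity_fanGraph (q : ℕ) : q + 2 ≤ strongArboricity (fanGraph q) (q + 2) := by
  have := card_le_strongArboricity (G := fanGraph q) (k := q + 2)
    (fun i : Option (Fin (q + 1)) => match i with
      | none => s(tip, mid 0) | some i => s(apex, mid i)) ?_ ?_
  · rwa [Nat.card_eq_fintype_card, Fintype.card_option, Fintype.card_fin] at this
  · rintro (_ | i)
    · exact isValidEdge_fanGraph_tip
    · exact isValidEdge_fanGraph_apex i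
  · intro S hS
    have ht : ¬ (apex ∈ S ∧ tip ∈ S ∧ mid 0 ∈ S) := by
      rintro ⟨ha, hb, hc⟩
      refine not_isAcyclic_of_triangle (G := (fanGraph q).induce S)
        (a := ⟨_, ha⟩) (b := ⟨_, hb⟩) (c := ⟨_, hc⟩) ?_ ?_ ?_ hS.1 <;>
        simp [fanGraph, FanVertex.Adj]
    rintro (_ | i) (_ | j) hi hj <;>
      have h1 := (mem_inducedEdges_iff.1 hi).2 <;> have h2 := (mem_inducedEdges_iff.1 hj).2
    · rfl
    · exact (ht ⟨h2.1, h1⟩).elim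
    · exact (ht ⟨h1.1, h2⟩).elim
    · by_contra hij
      have hr := root_mem_of_isStrongForest_fanGraph hS h1.2
      refine not_isAcyclic_of_square (G := (fanGraph q).induce S) (a := ⟨_, h1.1⟩)
        (b := ⟨_, h1.2⟩) (c := ⟨_, hr⟩) (d := ⟨_, h2.2⟩) ?_ ?_ ?_ ?_ ?_ ?_ hS.1 <;>
        simp_all [fanGraph, FanVertex.Adj]

theorem le_strongArboricity_fanGraph_of_pos {k : ℕ} (hk : 1 ≤ k) :
    k ≤ strongArboricity (fanGraph (k - 2)) k := by
  -- For `k = 1` the truncated subtraction gives `fanGraph 0`, where any edge suffices.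
  rcases Nat.lt_or_ge k 2 with h | h
  · obtain rfl : k = 1 := by omega
    exact one_le_strongArboricity (e := s(apex, tip)) (isValidEdge_one trivial)
  · obtain ⟨q, rfl⟩ := Nat.exists_eq_add_of_le' h
    exact le_strongArboricity_fanGraph q

theorem isTreeDecomposition_fanTree : IsTreeDecomposition (fanGraph q) (fanTree q) bag := by
  have hpar : ∀ v : FanVertex q, v ≠ root → (fanTree q).Adj v (par v) ∧ rank (par v) < rank v := by
    rintro (_ | _) h <;> simp_all [fanTree, TreeAdj, par, rank]
  refine ⟨⟨connected_of_rank rank root fun v => ?_, isAcyclic_of_rank rank par ?_⟩, ?_, ?_⟩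
  · by_cases hv : v = root
    · exact .inl hv
    · exact .inr ⟨_, hpar v hv⟩
  · rintro (_ | _) (_ | _) h <;> simp_all [fanTree, TreeAdj, par, rank]
  -- Each set has a top node `c` and is closed under taking parents elsewhere, hence is connected.
  · have key : ∀ v : FanVertex q, ∃ c ∈ bag v, ∀ x ∈ bag v,
        x = c ∨ (x ≠ root ∧ par x ∈ bag v) := by
      rintro (_ | _ | _ | i | x)
      · exact ⟨root, by simp [bag], by rintro (_ | _) <;> simp [bag, par]⟩
      · exact ⟨root, by simp [bag], by rintro (_ | _) <;> simp [bag, par]⟩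
      · exact ⟨tip, by simp [bag], by simp [bag]⟩
      · refine ⟨mid i, by simp [bag], ?_⟩
        rintro x (rfl | ⟨rfl, rfl⟩) <;> simp [bag, par]
      · exact ⟨leaf x, by simp [bag], by simp [bag]⟩
    intro v
    obtain ⟨c, hc, h⟩ := key v
    refine ⟨⟨c, hc⟩, connected_induce_of_rank rank hc fun x hx => ?_⟩
    rcases h x hx with rfl | ⟨h1, h2⟩
    · exact .inl rfl
    · exact .inr ⟨par x, h2, hpar x h1⟩
  · have key : ∀ u v : FanVertex q, (fanGraph q).Adj u v → u ∈ bag v ∨ v ∈ bag u ∨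
        tip ∈ bag u ∧ tip ∈ bag v := by
      rintro (_ | _) (_ | _) h <;> simp_all [fanGraph, FanVertex.Adj, bag]
    have hself : ∀ v : FanVertex q, v ∈ bag v := by rintro (_ | _) <;> simp [bag]
    intro u v h
    rcases key u v h with h | h | h
    · exact ⟨u, hself u, h⟩
    · exact ⟨v, h, hself v⟩
    · exact ⟨tip, h⟩

theorem encard_bag_le (x : FanVertex q) : {v | x ∈ bag v}.encard ≤ 3 := by
  have h3 : ∀ a b c : FanVertex q, ({a, b, c} : Set (FanVertex q)).encard ≤ 3 := fun a b c =>
    (Set.encard_insert_le _ _).trans (by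
      refine (add_le_add_left (encard_pair_le b c) 1).trans (by norm_num))
  rcases x with _ | _ | _ | i | x
  · refine (Set.encard_le_encard ?_).trans (h3 root apex apex)
    rintro (_ | _) h <;> simp_all [bag]
  · refine (Set.encard_le_encard ?_).trans (h3 root apex apex)
    rintro (_ | _) h <;> simp_all [bag]
  · refine (Set.encard_le_encard ?_).trans (h3 tip apex (mid 0))
    rintro (_ | _) h <;> simp_all [bag]
  · refine (Set.encard_le_encard ?_).trans (h3 root apex (mid i))
    rintro (_ | _) h <;> simp_all [bag]
  · refine (Set.encard_le_encard ?_).trans (h3 root (leaf x) (leaf x))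
    rintro (_ | _) h <;> simp_all [bag]

theorem treeWidth_fanGraph (q : ℕ) : treeWidth (fanGraph q) = 2 := by
  have hmem : 2 ∈ {w : ℕ | ∃ (ι : Type) (_ : Finite ι) (T : SimpleGraph ι)
      (B : FanVertex q → Set ι),
      IsTreeDecomposition (fanGraph q) T B ∧ ∀ x : ι, {v | x ∈ B v}.encard ≤ (w : ℕ∞) + 1} :=
    ⟨_, inferInstance, fanTree q, bag, isTreeDecomposition_fanTree,
      fun x => (encard_bag_le x).trans (by norm_num)⟩
  refine le_antisymm (Nat.sInf_le hmem) (le_csInf ⟨2, hmem⟩ ?_)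
  rintro w ⟨ι, -, T, B, hTB, hw⟩
  refine le_treeWidth_of_triangle (G := fanGraph q) (a := apex) (b := tip) (c := mid 0)
    ?_ ?_ ?_ hTB hw <;> simp [fanGraph, FanVertex.Adj]

end

/-- The graph `G` with `k` leaves attached to each vertex. -/
def pendantGraph {V : Type*} (G : SimpleGraph V) (k : ℕ) : SimpleGraph (V ⊕ V × Fin k) where
  Adj
    | .inl u, .inl v => G.Adj u v
    | .inl u, .inr x => u = x.1
    | .inr x, .inl u => u = x.1
    | .inr _, .inr _ => False
  symm := ⟨by rintro (_ | _) (_ | _) <;> simp [G.adj_comm]⟩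
  loopless := ⟨by rintro (_ | _) <;> simp⟩

section

variable {V : Type*} {G : SimpleGraph V} {k : ℕ}

/-- The pendant leaves supply the `k` edges, so any induced forest of `G` certified by a rank
extends to a `k`-strong one. -/
theorem isStrongForest_pendantGraph {S : Set V} (h : V → ℕ) (par : V → V)
    (H : ∀ v ∈ S, ∀ u ∈ S, G.Adj v u → h u ≤ h v → u = par v) :
    IsStrongForest (pendantGraph G k) k (Sum.elim id Prod.fst ⁻¹' S) := by
  refine .of_rank (Sum.elim h fun x => h x.1 + 1) (Sum.elim (.inl ∘ par) (.inl ∘ Prod.fst)) ?_ ?_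
  · rintro (v | v) hv (u | u) hu hvu hle
    · simpa using H v hv u hu hvu hle
    · obtain rfl : v = u.1 := hvu
      simp at hle
    · exact congrArg Sum.inl (show u = v.1 from hvu)
    · exact hvu.elim
  · rintro (v | v) hv
    · exact .inl (le_encard_of_injective (ι := Fin k) (by simp) (fun x => .inr (v, x))
        (fun x y h => by simpa using h) (fun x => ⟨rfl, hv⟩))
    · exact .inr ⟨.inl v.1, hv, rfl, by simp⟩

/-- `G` as an induced subgraph of `pendantGraph G k`. -/
noncomputable def pendantGraphIso (G : SimpleGraph V) (k : ℕ) :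
    G ≃g (pendantGraph G k).induce (Set.range Sum.inl) where
  toEquiv := Equiv.ofInjective _ Sum.inl_injective
  map_rel_iff' := Iff.rfl

theorem strongArboricity_pendantGraph_fanGraph (q k : ℕ) :
    strongArboricity (pendantGraph (fanGraph q) k) k = 3 := by
  have h0 : IsStrongForest (pendantGraph (fanGraph q) k) k
      (Sum.elim id Prod.fst ⁻¹' {v | v ≠ apex}) := by
    refine isStrongForest_pendantGraph rank par ?_
    rintro (_ | _) hv (_ | _) hu h hle <;> simp [fanGraph, FanVertex.Adj, rank, par] at * <;> tauto
  have h1 : IsStrongForest (pendantGraph (fanGraph q) k) k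
      (Sum.elim id Prod.fst ⁻¹' {v | v = apex ∨ ∃ i, v = mid i}) := by
    refine isStrongForest_pendantGraph (fun v => match v with | apex => 0 | _ => 1)
      (fun _ => apex) ?_
    rintro (_ | _) hv (_ | _) hu h hle <;> simp [fanGraph, FanVertex.Adj] at *
  have h2 : IsStrongForest (pendantGraph (fanGraph q) k) k
      (Sum.elim id Prod.fst ⁻¹' {v | v = apex ∨ v = tip}) := by
    refine isStrongForest_pendantGraph (fun v => match v with | apex => 0 | _ => 1)
      (fun _ => apex) ?_
    rintro (_ | _) hv (_ | _) hu h hle <;> simp [fanGraph, FanVertex.Adj] at *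
  refine le_antisymm (strongArboricity_le ![_, _, _]
    (Fin.forall_fin_succ.2 ⟨h0, Fin.forall_fin_two.2 ⟨h1, h2⟩⟩) ?_)
    (three_le_strongArboricity_of_triangle (a := .inl apex) (b := .inl tip) (c := .inl (mid 0))
      ⟨_, h2, ?_⟩ ⟨_, h0, ?_⟩ ⟨_, h1, ?_⟩)
  · intro e he
    induction e with
    | _ u v =>
      obtain ⟨S, -, h⟩ := he
      have h := (mem_inducedEdges_iff.1 h).1
      simp only [mem_inducedEdges_iff, h, true_and]
      -- Projected to `fanGraph`, a pendant edge collapses to a single vertex; hence the case `a =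
      -- b`.
      have key : ∀ a b : FanVertex q, a = b ∨ (fanGraph q).Adj a b →
          (a ≠ apex ∧ b ≠ apex) ∨ ((a = apex ∨ ∃ i, a = mid i) ∧ (b = apex ∨ ∃ i, b = mid i)) ∨
          ((a = apex ∨ a = tip) ∧ (b = apex ∨ b = tip)) := by
        rintro (_ | _) (_ | _) h <;> simp [fanGraph, FanVertex.Adj] at *
      have hab : Sum.elim id Prod.fst u = Sum.elim id Prod.fst v ∨
          (fanGraph q).Adj (Sum.elim id Prod.fst u) (Sum.elim id Prod.fst v) := by
        rcases u with u | u <;> rcases v with v | v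
        · exact .inr h
        · exact .inl h
        · exact .inl (show v = u.1 from h).symm
        · exact h.elim
      rcases key _ _ hab with h | h | h
      · exact ⟨0, h⟩
      · exact ⟨1, h⟩
      · exact ⟨2, h⟩
  all_goals
    simp [mem_inducedEdges_iff, pendantGraph, fanGraph, FanVertex.Adj]

end

end StrongArboricity

/-! ### Item (f): tree-depth three -/

namespace StrongArboricity

open SimpleGraph

/-- Vertices of `shallowGraph`. -/
inductive ShallowVertex (q : ℕ) : Type
  | root
  | apex
  | side
  | tip
  | mid (i : Fin q)
  | leaf (x : Fin (q + 1))

namespace ShallowVertex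

variable {q : ℕ}

instance : Finite (ShallowVertex q) :=
  Finite.of_injective (β := Fin 4 ⊕ Fin q ⊕ Fin (q + 1))
    (fun v => match v with
      | root => .inl 0
      | apex => .inl 1
      | side => .inl 2
      | tip => .inl 3
      | mid i => .inr (.inl i)
      | leaf x => .inr (.inr x)) (by
    rintro (_ | _) (_ | _) h <;> simp_all)

/-- The adjacency relation of `shallowGraph`. -/
def Adj : ShallowVertex q → ShallowVertex q → Prop
  | root, mid _ => True
  | mid _, root => True
  | root, leaf _ => True
  | leaf _, root => True
  | apex, mid _ => True
  | mid _, apex => True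
  | root, side => True
  | side, root => True
  | root, tip => True
  | tip, root => True
  | side, tip => True
  | tip, side => True
  | _, _ => False

/-- The adjacency relation of `shallowTree`. -/
def TreeAdj : ShallowVertex q → ShallowVertex q → Prop
  | root, apex => True
  | apex, root => True
  | root, leaf _ => True
  | leaf _, root => True
  | apex, mid _ => True
  | mid _, apex => True
  | root, side => True
  | side, root => True
  | side, tip => True
  | tip, side => True
  | _, _ => False

/-- The distance from `root` in `shallowTree`. -/
def rank : ShallowVertex q → ℕ
  | root => 0
  | tip => 2
  | mid _ => 2
  | _ => 1

/-- The parent of a vertex in `shallowTree`. -/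
def par : ShallowVertex q → ShallowVertex q
  | tip => side
  | mid _ => apex
  | _ => root

end ShallowVertex

open ShallowVertex

/-- The complete bipartite graph `K_{2, q}`, with a triangle and `q + 1` leaves attached to one of
its two vertices of degree `q`. -/
def shallowGraph (q : ℕ) : SimpleGraph (ShallowVertex q) where
  Adj := ShallowVertex.Adj
  symm := ⟨by rintro (_ | _) (_ | _) <;> simp [ShallowVertex.Adj]⟩
  loopless := ⟨by rintro (_ | _) <;> simp [ShallowVertex.Adj]⟩

/-- A tree of depth three whose transitive closure contains `shallowGraph`. -/
def shallowTree (q : ℕ) : SimpleGraph (ShallowVertex q) where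
  Adj := ShallowVertex.TreeAdj
  symm := ⟨by rintro (_ | _) (_ | _) <;> simp [ShallowVertex.TreeAdj]⟩
  loopless := ⟨by rintro (_ | _) <;> simp [ShallowVertex.TreeAdj]⟩

section

variable {q : ℕ}

theorem isValidEdge_shallowGraph (i : Fin q) :
    IsValidEdge (shallowGraph q) (q + 1) s(apex, mid i) := by
  refine ⟨{v | v = root ∨ v = apex ∨ v = mid i ∨ ∃ x, v = leaf x}, ?_,
    mem_inducedEdges_iff.2 ⟨by simp [shallowGraph, ShallowVertex.Adj], by simp, by simp⟩⟩
  refine .of_rank (fun v => match v with | root => 0 | apex => 2 | _ => 1)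
    (fun v => match v with | apex => mid i | _ => root) ?_ ?_
  · rintro (_ | _) hv (_ | _) hu h hle <;> simp [shallowGraph, ShallowVertex.Adj] at *
    exact hu
  · rintro v hv
    rcases hv with rfl | rfl | rfl | ⟨x, rfl⟩
    · exact .inl (le_encard_of_injective (ι := Fin (q + 1)) (by simp) leaf
        (fun _ _ h => by simpa using h) (fun x => by simp [shallowGraph, ShallowVertex.Adj]))
    · exact .inr ⟨mid i, by simp, by simp [shallowGraph, ShallowVertex.Adj], by simp⟩
    · exact .inr ⟨root, by simp, by simp [shallowGraph, ShallowVertex.Adj], by simp⟩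
    · exact .inr ⟨root, by simp, by simp [shallowGraph, ShallowVertex.Adj], by simp⟩

/-- Without `root`, the component of `apex` has at most `q + 1` vertices, and `q + 2` are needed. -/
theorem root_mem_of_isStrongForest_shallowGraph {S : Set (ShallowVertex q)}
    (hS : IsStrongForest (shallowGraph q) (q + 1) S) (ha : apex ∈ S) : root ∈ S := by
  by_contra hr
  let W : Set (ShallowVertex q) := insert apex (Set.range mid)
  have h1 := hS.card_le (W := W) ha (by simp [W]) (by
    rintro (_ | _) hx hxS (_ | _) hyS hadj <;> simp_all [shallowGraph, ShallowVertex.Adj, W])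
  have h2 := h1.trans (Set.ncard_le_ncard Set.inter_subset_left)
  have h4 : W.ncard ≤ (Set.range (mid : Fin q → ShallowVertex q)).ncard + 1 :=
    Set.ncard_insert_le _ _
  have h5 : (Set.range (mid : Fin q → ShallowVertex q)).ncard ≤ q := by
    rw [← Set.image_univ]
    exact (Set.ncard_image_le).trans (by simp)
  omega

theorem le_strongArboricity_shallowGraph (q : ℕ) :
    q ≤ strongArboricity (shallowGraph q) (q + 1) := by
  have := card_le_strongArboricity (G := shallowGraph q) (k := q + 1)
    (fun i : Fin q => s(apex, mid i)) isValidEdge_shallowGraph ?_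
  · simpa using this
  · intro S hS i j hi hj
    have h1 := (mem_inducedEdges_iff.1 hi).2
    have h2 := (mem_inducedEdges_iff.1 hj).2
    by_contra hij
    have hr := root_mem_of_isStrongForest_shallowGraph hS h1.1
    refine not_isAcyclic_of_square (G := (shallowGraph q).induce S) (a := ⟨_, h1.1⟩)
      (b := ⟨_, h1.2⟩) (c := ⟨_, hr⟩) (d := ⟨_, h2.2⟩) ?_ ?_ ?_ ?_ ?_ ?_ hS.1 <;>
      simp_all [shallowGraph, ShallowVertex.Adj]

theorem isRootedTreeOfDepthLE_shallowTree : IsRootedTreeOfDepthLE (shallowTree q) root 3 := by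
  refine isRootedTreeOfDepthLE_of_rank rank par ?_ ?_ ?_
  · rintro (_ | _) (_ | _) h <;> simp_all [shallowTree, TreeAdj, par, rank]
  · intro v
    by_cases hv : v = root
    · exact .inl hv
    · refine .inr ⟨par v, ?_⟩
      rcases v with _ | _ <;> simp_all [shallowTree, TreeAdj, par, rank]
  · rintro (_ | _) <;> simp [rank]

theorem shallowGraph_le_rootedClosure :
    shallowGraph q ≤ rootedClosure (shallowTree q) root := by
  have hroot : ∀ u : ShallowVertex q, ∃ p : (shallowTree q).Walk u root,
      p.IsPath ∧ root ∈ p.support := fun u => by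
    obtain ⟨p, hp⟩ := isRootedTreeOfDepthLE_shallowTree.1.connected.exists_isPath u root
    exact ⟨p, hp, p.end_mem_support⟩
  have h1 : (shallowTree q).Adj apex root := trivial
  have h2 : (shallowTree q).Adj side root := trivial
  have h3 : (shallowTree q).Adj tip side := trivial
  have hmid : ∀ i, ∃ p : (shallowTree q).Walk (mid i) root, p.IsPath ∧ apex ∈ p.support := by
    intro i
    have h4 : (shallowTree q).Adj (mid i) apex := trivial
    exact ⟨.cons h4 (.cons h1 .nil), by simp, by simp⟩
  have htip : ∃ p : (shallowTree q).Walk tip root, p.IsPath ∧ side ∈ p.support :=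
    ⟨.cons h3 (.cons h2 .nil), by simp, by simp⟩
  intro u v h
  refine (fromRel_adj _ _ _).2 ⟨h.ne, ?_⟩
  rcases u with _ | _ | _ | _ | i | x <;> rcases v with _ | _ | _ | _ | j | y <;>
    first
    | exact h.elim
    | exact .inl (hroot _)
    | exact .inr (hroot _)
    | exact .inl (hmid _)
    | exact .inr (hmid _)
    | exact .inl htip
    | exact .inr htip

/-- The triangle `root`, `side`, `tip` gives the lower bound for every `q`, even when there are no
vertices `mid i`. -/
theorem treeDepth_shallowGraph (q : ℕ) : treeDepth (shallowGraph q) = 3 := by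
  have hmem : 3 ∈ {d | ∀ c : (shallowGraph q).ConnectedComponent,
      ∃ (ι : Type) (_ : Finite ι) (T : SimpleGraph ι) (r : ι),
        IsRootedTreeOfDepthLE T r d ∧ c.toSimpleGraph.IsContained (rootedClosure T r)} := fun c =>
    ⟨_, inferInstance, shallowTree q, root, isRootedTreeOfDepthLE_shallowTree,
      IsContained.mono_right ⟨c.toSimpleGraph_hom, Subtype.val_injective⟩
        shallowGraph_le_rootedClosure⟩
  refine le_antisymm (Nat.sInf_le hmem) (le_csInf ⟨3, hmem⟩ fun d hd => ?_)
  refine le_treeDepth_of_triangle (G := shallowGraph q) (a := root) (b := side) (c := tip)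
    ?_ ?_ ?_ hd <;> simp [shallowGraph, ShallowVertex.Adj]

end

end StrongArboricity

/-! ### Part (iii): Cayley graphs of large girth and degree -/

namespace StrongArboricity

open SimpleGraph

/-- Words of length at most `R` over `Fin D` without two equal consecutive letters. -/
abbrev ReducedWord (D R : ℕ) : Type :=
  {w : List (Fin D) // w.IsChain (· ≠ ·) ∧ w.length ≤ R}

namespace ReducedWord

variable {D R : ℕ}

instance : Finite (ReducedWord D R) :=
  ((List.finite_length_le (Fin D) R).subset fun _ h => h.2).to_subtype

/-- The empty word. -/
def nil : ReducedWord D R := ⟨[], by simp⟩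

/-- Multiplication by the letter `i` from the left: `i` is deleted if it is the first letter,
and added otherwise, if the length allows it. -/
def mulLetter (i : Fin D) (w : ReducedWord D R) : ReducedWord D R :=
  if h : w.1.head? = some i then ⟨w.1.tail, w.2.1.tail, by
    have := w.2.2
    simp only [List.length_tail]
    omega⟩
  else if h' : w.1.length < R then ⟨i :: w.1, by
    refine ⟨?_, h'⟩
    rw [List.isChain_cons]
    exact ⟨fun y hy hiy => h (by rw [hiy]; exact hy), w.2.1⟩⟩
  else w

theorem mulLetter_val_of_head?_ne {i : Fin D} {w : ReducedWord D R} (h : w.1.head? ≠ some i)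
    (h' : w.1.length < R) : (mulLetter i w).1 = i :: w.1 := by
  simp [mulLetter, h, h']

/-- Adding and deleting a first letter undo each other; words of full length not starting with `i`
are fixed. -/
theorem mulLetter_involutive (i : Fin D) :
    Function.Involutive (mulLetter i : ReducedWord D R → ReducedWord D R) := by
  rintro ⟨w, hw, hl⟩
  rcases w with _ | ⟨j, w⟩
  · by_cases hR : 0 < R <;> simp [mulLetter, hR]
  · rw [List.isChain_cons] at hw
    by_cases hij : j = i
    · subst hij
      have h1 : w.head? ≠ some j := fun h => hw.1 j h rfl
      have h2 : w.length < R := by simpa using hl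
      simp [mulLetter, h1, h2]
    · by_cases hR : w.length + 1 < R <;> simp [mulLetter, hR, hij]

/-- Multiplication by the letter `i` as a permutation. -/
def letterPerm (i : Fin D) : Equiv.Perm (ReducedWord D R) := (mulLetter_involutive i).toPerm

theorem letterPerm_mul_self (i : Fin D) (x : Equiv.Perm (ReducedWord D R)) :
    letterPerm i * (letterPerm i * x) = x :=
  Equiv.ext fun w => mulLetter_involutive i (x w)

theorem letterPerm_nil (hR : 0 < R) (i : Fin D) : (letterPerm i (nil : ReducedWord D R)).1 = [i] :=
  mulLetter_val_of_head?_ne (by simp [nil]) (by simpa [nil])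

end ReducedWord

open ReducedWord

/-- The Cayley graph of the group of permutations of the reduced words of length at most `R`, with
respect to the multiplications by letters. -/
def reducedWordGraph (D R : ℕ) : SimpleGraph (Equiv.Perm (ReducedWord D R)) :=
  fromRel fun x y => ∃ i, y = letterPerm i * x

section

variable {D R : ℕ}

theorem exists_eq_of_reducedWordGraph_adj {x y : Equiv.Perm (ReducedWord D R)}
    (h : (reducedWordGraph D R).Adj x y) : ∃ i, y = letterPerm i * x := by
  rcases ((fromRel_adj _ _ _).1 h).2 with h | ⟨i, h⟩
  · exact h
  · exact ⟨i, by rw [h, letterPerm_mul_self]⟩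

/-- Distinct letters send the empty word to distinct nonempty words, so the generators are distinct
and nontrivial. -/
theorem le_encard_neighborSet_reducedWordGraph (hR : 0 < R) (x : Equiv.Perm (ReducedWord D R)) :
    (D : ℕ∞) ≤ ((reducedWordGraph D R).neighborSet x).encard := by
  refine le_encard_of_injective (ι := Fin D) (by simp) (fun i => letterPerm i * x) ?_ ?_
  · intro i j h
    have h1 := mul_right_cancel h
    have h2 := letterPerm_nil hR i
    rw [h1, letterPerm_nil hR j] at h2
    simpa using h2.symm
  · intro i
    rw [mem_neighborSet, reducedWordGraph, fromRel_adj]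
    refine ⟨fun h => ?_, .inl ⟨i, rfl⟩⟩
    have h1 : (letterPerm i : Equiv.Perm (ReducedWord D R)) = 1 := by simpa using h.symm
    have h2 := letterPerm_nil hR i
    rw [h1] at h2
    simp [nil] at h2

/-- The permutation `y * x⁻¹` is the product of the letters along the walk. Deleting a letter just
added would mean traversing the same edge again, so on a trail every step lengthens the word as long
as there is room. -/
theorem length_apply_of_isTrail {x y : Equiv.Perm (ReducedWord D R)}
    (p : (reducedWordGraph D R).Walk x y) (hp : p.IsTrail) (u : ReducedWord D R)
    (hl : u.1.length + p.length ≤ R)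
    (hu : ∀ i, u.1.head? = some i → s(x, letterPerm i * x) ∉ p.edges) :
    (y (x⁻¹ u)).1.length = u.1.length + p.length := by
  induction p generalizing u with
  | nil => simp
  | @cons x x' y h p ih =>
    obtain ⟨j, rfl⟩ := exists_eq_of_reducedWordGraph_adj h
    rw [Walk.length_cons] at hl
    rw [Walk.isTrail_cons] at hp
    have h1 : (letterPerm j u).1 = j :: u.1 :=
      mulLetter_val_of_head?_ne (fun hj => hu j hj (by simp)) (by omega)
    have h2 := ih hp.1 (letterPerm j u) (by rw [h1, List.length_cons]; omega) (by
      intro i hi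
      rw [h1, List.head?_cons, Option.some_inj] at hi
      rw [← hi, letterPerm_mul_self, Sym2.eq_swap]
      exact hp.2)
    have h3 : (letterPerm j * x : Equiv.Perm (ReducedWord D R))⁻¹ (letterPerm j u) = x⁻¹ u := by simp
    rw [h1, h3] at h2
    rw [h2, Walk.length_cons, List.length_cons]
    omega

/-- A closed walk fixes the empty word, but a short cycle would lengthen it. -/
theorem lt_length_of_isCycle_reducedWordGraph {x : Equiv.Perm (ReducedWord D R)}
    (p : (reducedWordGraph D R).Walk x x) (hp : p.IsCycle) : R < p.length := by
  by_contra! hl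
  have h1 := length_apply_of_isTrail p hp.isTrail nil (by simpa [nil]) (by simp [nil])
  have h2 := hp.three_le_length
  have h3 : x (x⁻¹ nil) = nil := by simp
  rw [h3] at h1
  omega

end

/-! ### Density of covers, and short cycles from shallow minors -/

section

variable {V : Type*} {G : SimpleGraph V}

theorem ncard_edgeSet_le_of_isAcyclic [Finite V] (hG : G.IsAcyclic) :
    G.edgeSet.ncard ≤ Nat.card V := by
  classical
  have := Fintype.ofFinite V
  rcases isEmpty_or_nonempty V with hV | hV
  · rw [Subsingleton.elim G ⊥]
    simp
  · obtain ⟨T, hT, -, hle⟩ := connected_top.exists_isTree_le_of_le_of_isAcyclic le_top hG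
    have h1 := hle.card_edgeFinset
    have h2 := Set.ncard_le_ncard (edgeSet_mono hT)
    rw [← coe_edgeFinset T, Set.ncard_coe_finset] at h2
    rw [Nat.card_eq_fintype_card]
    omega

theorem ncard_inducedEdges_le [Finite V] {S : Set V} (hS : (G.induce S).IsAcyclic) :
    (inducedEdges G S).ncard ≤ Nat.card V := by
  have h1 : inducedEdges G S ⊆ Sym2.map Subtype.val '' (G.induce S).edgeSet := by
    intro e he
    induction e with
    | _ u v =>
      obtain ⟨h, hu, hv⟩ := mem_inducedEdges_iff.1 he
      exact ⟨s(⟨u, hu⟩, ⟨v, hv⟩), h, rfl⟩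
  calc (inducedEdges G S).ncard ≤ _ := Set.ncard_le_ncard h1
    _ ≤ _ := Set.ncard_image_le
    _ ≤ _ := ncard_edgeSet_le_of_isAcyclic hS
    _ ≤ _ := Nat.card_le_card_of_injective _ Subtype.val_injective

/-- In a triangle-free graph a vertex and its neighbours induce a star. -/
theorem isValidEdge_of_cliqueFree {k : ℕ} (hG : ∀ a b c, G.Adj a b → G.Adj b c → ¬ G.Adj a c)
    {u v : V} (hu : (k : ℕ∞) ≤ (G.neighborSet u).encard) (huv : G.Adj u v) :
    IsValidEdge G k s(u, v) := by
  classical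
  refine ⟨insert u (G.neighborSet u), .of_rank (fun x => if x = u then 0 else 1) (fun _ => u) ?_ ?_,
    mem_inducedEdges_iff.2 ⟨huv, .inl rfl, .inr huv⟩⟩
  · rintro a (rfl | ha) b (rfl | hb) hab hle
    · rfl
    · simp [hab.ne'] at hle
    · rfl
    · exact (hG u a b ha hab hb).elim
  · rintro a (rfl | ha)
    · left
      rwa [Set.inter_eq_left.2 (Set.subset_insert _ _)]
    · exact .inr ⟨u, .inl rfl, ha.symm, by simp [(show G.Adj u a from ha).ne']⟩

/-- All edges are valid and each forest has at most `|V|` edges, so `D |V| ≤ 2 |E| ≤ 2 f_k |V|`. -/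
theorem le_two_mul_strongArboricity [Finite V] [Nonempty V] {D k : ℕ} (hk : k ≤ D)
    (hG : ∀ a b c, G.Adj a b → G.Adj b c → ¬ G.Adj a c)
    (hD : ∀ v, (D : ℕ∞) ≤ (G.neighborSet v).encard) : D ≤ 2 * strongArboricity G k := by
  classical
  have := Fintype.ofFinite V
  obtain ⟨F, hF, hcov⟩ := exists_cover_strongArboricity G k
  have h1 : G.edgeFinset ⊆ Finset.univ.biUnion fun i => (inducedEdges G (F i)).toFinset := by
    intro e he
    induction e with
    | _ u v =>
      rw [mem_edgeFinset, mem_edgeSet] at he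
      obtain ⟨i, hi⟩ := hcov _ (isValidEdge_of_cliqueFree hG
        ((Nat.cast_le.2 hk).trans (hD u)) he)
      simp only [Finset.mem_biUnion, Set.mem_toFinset]
      exact ⟨i, Finset.mem_univ _, hi⟩
  have h2 : G.edgeFinset.card ≤ strongArboricity G k * Fintype.card V := by
    refine (Finset.card_le_card h1).trans (Finset.card_biUnion_le.trans ?_)
    refine (Finset.sum_le_card_nsmul _ _ (Fintype.card V) fun i _ => ?_).trans (by simp)
    rw [← Set.ncard_eq_toFinset_card', ← Nat.card_eq_fintype_card]
    exact ncard_inducedEdges_le (hF i).1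
  have h3 : Fintype.card V * D ≤ ∑ v, G.degree v := by
    refine le_trans (by simp) (Finset.card_nsmul_le_sum Finset.univ _ D fun v _ => ?_)
    have := hD v
    rw [← coe_neighborFinset, Set.encard_coe_eq_coe_finsetCard] at this
    exact_mod_cast this
  rw [sum_degrees_eq_twice_card_edges] at h3
  refine Nat.le_of_mul_le_mul_left (h3.trans ?_) Fintype.card_pos
  calc 2 * G.edgeFinset.card ≤ 2 * (strongArboricity G k * Fintype.card V) := by gcongr
    _ = _ := by ring

theorem isCycle_triangle {a b c : V} (hab : G.Adj a b) (hbc : G.Adj b c) (hca : G.Adj c a) :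
    (Walk.cons hab (.cons hbc (.cons hca .nil))).IsCycle := by
  simp [Walk.cons_isCycle_iff, hab.ne, hbc.ne, hca.ne, hab.ne', hca.ne']

theorem exists_walk_of_radius_le {d : ℕ} {S : Set V} (hS : (G.induce S).Connected)
    (hd : ∃ c : S, ∀ x : S, (G.induce S).dist c x ≤ d) {x y : V} (hx : x ∈ S) (hy : y ∈ S) :
    ∃ p : G.Walk x y, p.length ≤ 2 * d ∧ ∀ z ∈ p.support, z ∈ S := by
  obtain ⟨c, hc⟩ := hd
  obtain ⟨p, hp⟩ := hS.exists_walk_length_eq_dist ⟨x, hx⟩ ⟨y, hy⟩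
  have h1 := hS.dist_triangle (u := ⟨x, hx⟩) (v := c) (w := ⟨y, hy⟩)
  have h2 := hc ⟨x, hx⟩
  have h3 := hc ⟨y, hy⟩
  rw [dist_comm] at h2
  refine ⟨p.map (Embedding.induce S).toHom, ?_, ?_⟩
  · have h4 : (p.map (Embedding.induce S).toHom).length = p.length := Walk.length_map _ _
    exact h4.le.trans (by omega)
  · intro z hz
    obtain ⟨y, -, rfl⟩ := List.mem_map.1
      ((congrArg (z ∈ ·) (Walk.support_map (Embedding.induce S).toHom p)).mp hz)
    exact y.2

theorem exists_short_cycle_of_isShallowMinor {W : Type*} {H : SimpleGraph W} {d : ℕ}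
    (h : IsShallowMinor d G H) {a b c : V} (hab : G.Adj a b) (hbc : G.Adj b c) (hac : G.Adj a c) :
    ∃ x, ∃ p : H.Walk x x, p.IsCycle ∧ p.length ≤ 6 * d + 3 := by
  classical
  obtain ⟨B, hdisj, hB, hE⟩ := h
  have hdis : ∀ {u v x}, u ≠ v → x ∈ B u → x ∉ B v := fun huv hx hx' =>
    Set.disjoint_left.1 (hdisj _ _ huv) hx hx'
  obtain ⟨x₁, hx₁, y₁, hy₁, h₁⟩ := hE _ _ hab
  obtain ⟨x₂, hx₂, y₂, hy₂, h₂⟩ := hE _ _ hbc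
  obtain ⟨x₃, hx₃, y₃, hy₃, h₃⟩ := hE _ _ hac
  obtain ⟨p, hpl, hp⟩ := exists_walk_of_radius_le (hB b).1 (hB b).2 hy₁ hx₂
  obtain ⟨q, hql, hq⟩ := exists_walk_of_radius_le (hB c).1 (hB c).2 hy₂ hy₃
  obtain ⟨r, hrl, hr⟩ := exists_walk_of_radius_le (hB a).1 (hB a).2 hx₃ hx₁
  let w := p.append (.cons h₂ (q.append (.cons h₃.symm r)))
  -- The rest of the closed walk never uses this edge, so shortcutting it to a path and adding the
  -- edge gives a cycle. The length is at most three passages of `2 * d` and three connecting edges.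
  have hw : s(x₁, y₁) ∉ w.edges := by
    simp only [w, Walk.edges_append, Walk.edges_cons, List.mem_append, List.mem_cons, not_or]
    refine ⟨fun h => ?_, fun h => ?_, fun h => ?_, fun h => ?_, fun h => ?_⟩
    · exact hdis hab.ne hx₁ (hp _ (p.fst_mem_support_of_mem_edges h))
    · rcases Sym2.eq_iff.1 h with ⟨rfl, rfl⟩ | ⟨rfl, rfl⟩
      · exact hdis hab.ne hx₁ hx₂
      · exact hdis hac.ne hx₁ hy₂
    · exact hdis hac.ne hx₁ (hq _ (q.fst_mem_support_of_mem_edges h))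
    · rcases Sym2.eq_iff.1 h with ⟨rfl, rfl⟩ | ⟨rfl, rfl⟩
      · exact hdis hac.ne hx₁ hy₃
      · exact hdis hbc.ne hy₁ hy₃
    · exact hdis hab.ne (hr _ (r.snd_mem_support_of_mem_edges h)) hy₁
  refine ⟨x₁, .cons h₁ w.bypass, (Walk.cons_isCycle_iff _ _).2 ⟨w.bypass_isPath, fun h => hw ?_⟩, ?_⟩
  · exact w.edges_bypass_subset_edges h
  · have h1 := w.length_bypass_le_length
    have h2 : w.length = p.length + (q.length + (r.length + 1) + 1) := by simp [w]
    rw [Walk.length_cons]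
    omega

theorem card_le_of_isShallowMinor {W : Type*} [Finite W] {H : SimpleGraph W} {d : ℕ}
    (h : IsShallowMinor d G H) : Nat.card V ≤ Nat.card W := by
  obtain ⟨B, hdisj, hB, -⟩ := h
  choose f hf using fun v => Set.nonempty_coe_sort.1 (hB v).1.nonempty
  refine Nat.card_le_card_of_injective f fun u v huv => ?_
  by_contra hne
  exact Set.disjoint_left.1 (hdisj u v hne) (hf u) (huv ▸ hf v)

end

/-- For fixed `d`, large `n` excludes even a triangle; the finitely many other graphs are excluded
by a complete graph with more vertices than any of them. -/
theorem isNowhereDenseClass_range_of_girth {G : ℕ → FinGraph}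
    (hG : ∀ n x (p : (G n).graph.Walk x x), p.IsCycle → n < p.length) :
    IsNowhereDenseClass (Set.range G) := by
  intro d
  let M := ∑ n ∈ Finset.range (6 * d + 3), Nat.card (G n).V
  refine ⟨⟨Fin (M + 3), ⊤⟩, ?_⟩
  rintro _ ⟨n, rfl⟩ h
  by_cases hn : n < 6 * d + 3
  · have h1 := card_le_of_isShallowMinor h
    have h2 : Nat.card (G n).V ≤ M := Finset.single_le_sum
      (f := fun n => Nat.card (G n).V) (fun _ _ => Nat.zero_le _) (Finset.mem_range.2 hn)
    rw [Nat.card_eq_fintype_card, Fintype.card_fin] at h1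
    omega
  · obtain ⟨x, p, hp, hl⟩ := exists_short_cycle_of_isShallowMinor (a := (⟨0, by omega⟩ : Fin (M + 3)))
      (b := ⟨1, by omega⟩) (c := ⟨2, by omega⟩) h (by simp) (by simp) (by simp)
    have := hG n x p hp
    omega

theorem exists_isNowhereDenseClass : ∃ C : GraphClass, IsNowhereDenseClass C ∧
    ∀ k : ℕ, 1 ≤ k → ¬ IsStrongArboricityBounded k C := by
  -- Degree `2 * n` gives `f_k ≥ n` once `k ≤ 2 * n`; the summand `3` also excludes triangles.
  let G : ℕ → FinGraph := fun n => ⟨_, reducedWordGraph (2 * n) (n + 3)⟩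
  refine ⟨Set.range G, isNowhereDenseClass_range_of_girth fun n x p hp => ?_, ?_⟩
  · have := lt_length_of_isCycle_reducedWordGraph p hp
    omega
  · rintro k - ⟨c, hc⟩
    have h1 := hc _ ⟨k + c + 1, rfl⟩
    have h2 := le_two_mul_strongArboricity
      (G := reducedWordGraph (2 * (k + c + 1)) (k + c + 1 + 3)) (k := k) (by omega) ?_
      (le_encard_neighborSet_reducedWordGraph (by omega))
    · change strongArboricity (reducedWordGraph _ _) k ≤ c at h1
      omega
    · intro x y z hxy hyz hxz
      have := lt_length_of_isCycle_reducedWordGraph _ (isCycle_triangle hxy hyz hxz.symm)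
      simp at this

/-- The branch sets are stars around branch vertices, taking the nearer inner vertex of each path;
the middle edges join them. -/
theorem isShallowMinor_gadgetGraph {V : Type*} [Finite V] (G : SimpleGraph V) (q : ℕ) :
    IsShallowMinor 1 G (gadgetGraph (Nat.card V) 1 q) := by
  let e := Finite.equivFin V
  let B : V → Set (GadgetVertex (Nat.card V) 1 q) := fun v => {x | x = .branch (e v) ∨
    (∃ j m, x = .fst (e v) j m) ∨ ∃ j m, x = .snd j (e v) m}
  refine ⟨B, fun u v huv => Set.disjoint_left.2 ?_, fun v => ?_, fun u v h => ?_⟩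
  · have := e.injective.ne huv
    rintro x (rfl | ⟨j, m, rfl⟩ | ⟨j, m, rfl⟩) <;> simp [B, this]
  · have hb : GadgetVertex.branch (e v) ∈ B v := .inl rfl
    have hadj : ∀ x ∈ B v, x = .branch (e v) ∨
        (gadgetGraph (Nat.card V) 1 q).Adj (.branch (e v)) x := by
      rintro x (rfl | ⟨j, m, rfl⟩ | ⟨j, m, rfl⟩) <;> simp [gadgetGraph, GadgetVertex.Adj]
    refine ⟨connected_induce_of_rank (fun x => match x with | .branch _ => 0 | _ => 1) hb ?_,
      ⟨_, hb⟩, ?_⟩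
    · intro x hx
      rcases hx with rfl | ⟨j, m, rfl⟩ | ⟨j, m, rfl⟩
      · exact .inl rfl
      · exact .inr ⟨_, hb, by simp [gadgetGraph, GadgetVertex.Adj], by simp⟩
      · exact .inr ⟨_, hb, by simp [gadgetGraph, GadgetVertex.Adj], by simp⟩
    · rintro ⟨x, hx⟩
      rcases hadj x hx with rfl | h
      · simp
      · exact (dist_eq_one_iff_adj.2 (show ((gadgetGraph (Nat.card V) 1 q).induce (B v)).Adj
          ⟨_, hb⟩ ⟨x, hx⟩ from h)).le
  · exact ⟨.fst (e u) (e v) 0, .inr (.inl ⟨_, _, rfl⟩), .snd (e u) (e v) 0, .inr (.inr ⟨_, _, rfl⟩),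
      by simp [gadgetGraph, GadgetVertex.Adj]⟩

theorem exists_isStrongArboricityBounded_class : ∃ C : GraphClass,
    (∀ k : ℕ, 1 ≤ k → IsStrongArboricityBounded k C) ∧ ¬ IsNowhereDenseClass C := by
  -- With `n` leaves per path, three forests suffice as soon as `k ≤ n`; the finitely many smaller
  -- `n` are absorbed by a sum.
  let G : ℕ → FinGraph := fun n => ⟨_, gadgetGraph n 1 n⟩
  refine ⟨Set.range G, fun k _ => ?_, fun h => ?_⟩
  · refine ⟨3 + ∑ n ∈ Finset.range k, strongArboricity (G n).graph k, ?_⟩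
    rintro _ ⟨n, rfl⟩
    by_cases hn : n < k
    · have : strongArboricity (G n).graph k ≤ ∑ n ∈ Finset.range k, strongArboricity (G n).graph k :=
        Finset.single_le_sum (f := fun n => strongArboricity (G n).graph k)
          (fun _ _ => Nat.zero_le _) (Finset.mem_range.2 hn)
      omega
    · have : strongArboricity (G n).graph k ≤ 3 :=
        strongArboricity_gadgetGraph_le (by omega) (by omega)
      omega
  · obtain ⟨X, hX⟩ := h 1
    exact hX _ ⟨Nat.card X.V, rfl⟩ (isShallowMinor_gadgetGraph X.graph _)

end StrongArboricity

theorem theorem2 :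
    -- (i)
    (∀ (V : Type*) [Finite V] (G : SimpleGraph V),
      Real.logb 3 (StrongArboricity.acyclicChromaticNumber G : ℝ)
          ≤ (StrongArboricity.strongArboricity G 1 : ℝ) ∧
        StrongArboricity.strongArboricity G 1
          ≤ (StrongArboricity.acyclicChromaticNumber G).choose 2) ∧
    -- (ii)
    (∀ k n : ℕ, 1 ≤ k → 1 ≤ n →
      (∃ G : StrongArboricity.FinGraph,
        StrongArboricity.edgeArboricity G.graph = 2 ∧
          n ≤ StrongArboricity.strongArboricity G.graph k) ∧
      (∃ G : StrongArboricity.FinGraph,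
        StrongArboricity.strongArboricity G.graph k ≤ 3 ∧
          n ≤ StrongArboricity.strongArboricity G.graph (k + 1)) ∧
      (∃ G : StrongArboricity.FinGraph,
        n ≤ StrongArboricity.strongArboricity G.graph k ∧
          StrongArboricity.strongArboricity G.graph (k + 1) = 0) ∧
      (∃ G : StrongArboricity.FinGraph, ∃ S : Set G.V,
        StrongArboricity.strongArboricity G.graph k = 3 ∧
          k ≤ StrongArboricity.strongArboricity (G.graph.induce S) k) ∧
      (∃ G : StrongArboricity.FinGraph,
        StrongArboricity.treeWidth G.graph = 2 ∧
          k ≤ StrongArboricity.strongArboricity G.graph k) ∧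
      (∃ G : StrongArboricity.FinGraph,
        StrongArboricity.treeDepth G.graph = 3 ∧
          k - 1 ≤ StrongArboricity.strongArboricity G.graph k)) ∧
    -- (iii)
    (∃ C : StrongArboricity.GraphClass, StrongArboricity.IsNowhereDenseClass C ∧
      ∀ k : ℕ, 1 ≤ k → ¬ StrongArboricity.IsStrongArboricityBounded k C) ∧
    -- (iv)
    (∃ C : StrongArboricity.GraphClass,
      (∀ k : ℕ, 1 ≤ k → StrongArboricity.IsStrongArboricityBounded k C) ∧
      ¬ StrongArboricity.IsNowhereDenseClass C) := by
  refine ⟨fun V _ G => ⟨StrongArboricity.logb_acyclicChromaticNumber_le G,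
    StrongArboricity.strongArboricity_one_le_choose G⟩, ?_,
    StrongArboricity.exists_isNowhereDenseClass,
    StrongArboricity.exists_isStrongArboricityBounded_class⟩
  intro k n hk hn
  -- With `k = q + 1`, the `q` leaves in items (b) and (c) separate `k` from `k + 1`.
  obtain ⟨q, rfl⟩ := Nat.exists_eq_add_of_le' hk
  have hpow : 1 ≤ 2 ^ n := Nat.one_le_two_pow
  refine ⟨⟨⟨_, StrongArboricity.subdivGraph (2 ^ n + 1) (n + (q + 1))⟩,
      StrongArboricity.edgeArboricity_subdivGraph (by omega) (by omega),
      StrongArboricity.le_strongArboricity_subdivGraph _ n⟩,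
    ⟨⟨_, StrongArboricity.gadgetGraph (2 ^ n + 1) (n + q + 1) q⟩,
      StrongArboricity.strongArboricity_gadgetGraph_le le_rfl (by nlinarith),
      StrongArboricity.le_strongArboricity_gadgetGraph (Nat.le_add_right n q) q⟩,
    ⟨⟨_, StrongArboricity.starredCompleteGraph q n⟩,
      StrongArboricity.le_strongArboricity_starredCompleteGraph q n,
      StrongArboricity.strongArboricity_starredCompleteGraph_eq_zero q n⟩,
    ⟨⟨_, StrongArboricity.pendantGraph (StrongArboricity.fanGraph (q + 1 - 2)) (q + 1)⟩,
      Set.range Sum.inl, StrongArboricity.strongArboricity_pendantGraph_fanGraph _ _,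
      (StrongArboricity.le_strongArboricity_fanGraph_of_pos hk).trans
        (StrongArboricity.strongArboricity_le_of_iso
          (StrongArboricity.pendantGraphIso _ _) _)⟩,
    ⟨⟨_, StrongArboricity.fanGraph (q + 1 - 2)⟩, StrongArboricity.treeWidth_fanGraph _,
      StrongArboricity.le_strongArboricity_fanGraph_of_pos hk⟩,
    ⟨⟨_, StrongArboricity.shallowGraph q⟩, StrongArboricity.treeDepth_shallowGraph q,
      StrongArboricity.le_strongArboricity_shallowGraph q⟩⟩
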